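/- Let $p$ be a prime, $L/\mathbb{Q}_p$ and $K/L$ finite extensions with rings of integers $\mathcal{O}_L,\mathcal{O}_K$, let $\pi_L,\pi_K$ be uniformizers, and let $q_L=|\mathcal{O}_L/\pi_L|$, $q_K=|\mathcal{O}_K/\pi_K|=q_L^{f_{K/L}}$. Put $f_L(x)=\pi_Lx+x^{q_L}$ and $f_K(x)=\pi_Kx+x^{q_K}$. Let $F_L$, $F_K$ be the Lubin-Tate formal group laws attached to $f_L$, $f_K$ (the unique formal group law $F$ with $f(F(x,y))=F(f(x),f(y))$), write $\oplus_L,\oplus_K$ for the corresponding additions and $\sum^{\mathrm{LT},L}$ for summation with respect to $\oplus_L$, and let $[a]_L$ (for $a\in\mathcal{O}_L$), $[a]_K$ (for $a\in\mathcal{O}_K$) be the corresponding endomorphisms, i.e. the unique series $\equiv ax$ modulo degree $2$ that commute with $f_L$, resp. $f_K$, under composition. Let $\mathfrak{F}_0(F_K)$ be the set of all $q_K$ roots of $f_K$ in an algebraic closure of $K$. For $\alpha\in\mathcal{O}_L$ let $\mathscr{A}^\alpha_{L,K}$ be the set of all $r\in\mathcal{O}_K[[x]]$ with $|r(0)|<1$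 and $$\sum^{\mathrm{LT},L}_{z\in\mathfrak{F}_0(F_K)}r(x\oplus_Kz)=[\alpha]_L\bigl(r([\pi_K]_K(x))\bigr),$$ all composites being taken as coefficientwise limits. Assume $q_L\ge 3$, $\pi_K^2\mid\pi_L$, and that $\alpha=q_K/\pi_L^{f_{K/L}}$ lies in $\mathcal{O}_L$ and is divisible by $\pi_L$. Then for every $s\in\mathcal{O}_K[[x]]$ with $|s(0)|<1$ there exists $r\in\mathscr{A}^\alpha_{L,K}$ with $r\equiv s \bmod \pi_K$ if and only if $$\sum^{\mathrm{LT},L}_{z\in\mathfrak{F}_0(F_K)}s(x\oplus_Kz)\equiv[\alpha]_L\bigl(s([\pi_K]_K(x))\bigr)\mod \pi_K^2.$$ -/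

import Mathlib

open Polynomial PowerSeries

noncomputable section

namespace ColemanTrace

/-! ### Rings of integers of finite extensions of `ℚ_p` -/

/-- The ring of integers of an extension `F` of `ℚ_p`: the elements integral over `ℤ_p`. -/
abbrev Integers (p : ℕ) [Fact p.Prime] (F : Type*) [Field F] [Algebra ℚ_[p] F] :
    Subalgebra (PadicInt.subring p) F :=
  integralClosure (PadicInt.subring p) F

/-- The inclusion `𝒪_E → 𝒪_F` for an extension `F / E` of extensions of `ℚ_p`. -/
def integersMap (p : ℕ) [Fact p.Prime] (E F : Type*) [Field E] [Field F] [Algebra ℚ_[p] E]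
    [Algebra ℚ_[p] F] [Algebra E F] [IsScalarTower ℚ_[p] E F] :
    Integers p E →+* Integers p F :=
  (((IsScalarTower.toAlgHom ℚ_[p] E F).restrictScalars
    (PadicInt.subring p)).mapIntegralClosure : Integers p E →ₐ[PadicInt.subring p] Integers p F)

/-- The size `q` of the residue ring `R / πR`. -/
def residueCard {R : Type*} [CommRing R] (π : R) : ℕ :=
  Nat.card (R ⧸ Ideal.span {π})

/-! ### Lubin-Tate formal group laws and their endomorphisms -/

/-- The polynomial `π x + x ^ q`, where `q = |R / πR|`. -/
def basicPoly {R : Type*} [CommRing R] (π : R) : R[X] :=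
  Polynomial.C π * Polynomial.X + Polynomial.X ^ residueCard π

/-- The polynomial `π x + x ^ q` as a power series. -/
def basicSeries {R : Type*} [CommRing R] (π : R) : R⟦X⟧ :=
  (basicPoly π : R⟦X⟧)

/-- `F` is the formal group law attached to `f`: `f (F (x, y)) = F (f x, f y)`.
(The structure `FormalGroup` contains `F (x, y) ≡ x + y` modulo degree two.) -/
def IsLubinTateLaw {R : Type*} [CommRing R] (f : R⟦X⟧) (F : FormalGroup R) : Prop :=
  PowerSeries.subst F.toPowerSeries f =
    MvPowerSeries.subst
      (fun i : Fin 2 => PowerSeries.subst (MvPowerSeries.X i : MvPowerSeries (Fin 2) R) f)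
      F.toPowerSeries

open Classical in
/-- The Lubin-Tate formal group law attached to `f`. For a Lubin-Tate series `f` over the ring of
integers of a local field there is exactly one formal group law attached to `f`. -/
def lubinTateLaw {R : Type*} [CommRing R] (f : R⟦X⟧) : FormalGroup R :=
  if h : ∃ F, IsLubinTateLaw f F then h.choose else FormalGroup.𝔾ₐ

/-- `φ` is the endomorphism `[a]` attached to `f`: `φ (x) ≡ a x` modulo degree two and
`f (φ (x)) = φ (f (x))`. -/
def IsLubinTateEndo {R : Type*} [CommRing R] (f : R⟦X⟧) (a : R) (φ : R⟦X⟧) : Prop :=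
  PowerSeries.coeff 0 φ = 0 ∧ PowerSeries.coeff 1 φ = a ∧
    PowerSeries.subst φ f = PowerSeries.subst f φ

open Classical in
/-- The endomorphism `[a]` of the Lubin-Tate formal group law attached to `f`. For a Lubin-Tate
series `f` over the ring of integers of a local field there is exactly one such series. -/
def lubinTateEndo {R : Type*} [CommRing R] (f : R⟦X⟧) (a : R) : R⟦X⟧ :=
  if h : ∃ φ, IsLubinTateEndo f a φ then h.choose else 0

/-! ### Substitution by coefficientwise convergence -/

/-- The composite `h (g)` of a power series `h` in variables indexed by `σ` with a family `g` of
series in `A⟦X⟧`, as a coefficientwise limit for the `p`-adic topology of `A`: its `n`-th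
coefficient is the sum over all monomials `d` of `(coeff of d in h) * (n-th coeff of g ^ d)`. -/
def compSeries {σ A : Type*} [CommRing A] (p : ℕ) (h : MvPowerSeries σ A) (g : σ → A⟦X⟧) : A⟦X⟧ :=
  PowerSeries.mk fun n =>
    letI : TopologicalSpace A := (Ideal.span {(p : A)}).adicTopology
    ∑' d : σ →₀ ℕ, MvPowerSeries.coeff d h * PowerSeries.coeff n (d.prod fun i k => g i ^ k)

/-- The composite `h (g)` for a power series `h` in one variable. -/
def comp₁ {A : Type*} [CommRing A] (p : ℕ) (h g : A⟦X⟧) : A⟦X⟧ :=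
  compSeries (σ := Unit) p h (fun _ => g)

/-- The sum `g₁ ⊕ g₂ = F (g₁, g₂)` with respect to a formal group law `F`. -/
def fglAdd {A : Type*} [CommRing A] (p : ℕ) (F : FormalGroup A) (g₁ g₂ : A⟦X⟧) : A⟦X⟧ :=
  compSeries p F.toPowerSeries ![g₁, g₂]

/-- The sum of the family `g` over the finite set `T` with respect to a formal group law `F`.
(The terms are added in some order, on which nothing depends for a commutative law.) -/
def fglSum {A ι : Type*} [CommRing A] (p : ℕ) (F : FormalGroup A) (T : Finset ι) (g : ι → A⟦X⟧) :
    A⟦X⟧ :=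
  T.toList.foldr (fun z acc => fglAdd p F (g z) acc) 0

/-! ### The setting: `K / L / ℚ_p` with uniformizers `πK`, `πL` -/

section Setting

variable (p : ℕ) [Fact p.Prime]

/-- The extension of `K` generated by the roots of `f_K = πK x + x ^ qK`. -/
abbrev TorsionField {K : Type*} [Field K] [Algebra ℚ_[p] K] (πK : Integers p K) : Type _ :=
  ((basicPoly πK).map (algebraMap (Integers p K) K)).SplittingField

/-- The ring of integers of the extension of `K` generated by the roots of `f_K`. -/
abbrev TorsionIntegers {K : Type*} [Field K] [Algebra ℚ_[p] K] (πK : Integers p K) : Type _ :=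
  Integers p (TorsionField p πK)

/-- The inclusion of `𝒪_K` into the ring of integers of the field generated by the roots
of `f_K`. -/
def inclK {K : Type*} [Field K] [Algebra ℚ_[p] K] (πK : Integers p K) :
    Integers p K →+* TorsionIntegers p πK :=
  integersMap p K (TorsionField p πK)

open Classical in
/-- The set of all roots of `f_K = πK x + x ^ qK`. -/
def torsionPoints {K : Type*} [Field K] [Algebra ℚ_[p] K] (πK : Integers p K) :
    Finset (TorsionIntegers p πK) :=
  ((basicPoly πK).map (inclK p πK)).roots.toFinset

/-- The series `x ⊕_K z`, for a root `z` of `f_K`. -/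
def translate {K : Type*} [Field K] [Algebra ℚ_[p] K] (πK : Integers p K)
    (z : TorsionIntegers p πK) : (TorsionIntegers p πK)⟦X⟧ :=
  fglAdd p ((lubinTateLaw (basicSeries πK)).map (inclK p πK)) PowerSeries.X (PowerSeries.C z)

variable {L K : Type*} [Field L] [Field K] [Algebra ℚ_[p] L] [Algebra ℚ_[p] K] [Algebra L K]
  [IsScalarTower ℚ_[p] L K]

/-- The series `∑ s (x ⊕_K z)`, where `z` runs over the roots of `f_K` and the sum is taken with
respect to the formal group law `F_L`. -/
def traceSum (πL : Integers p L) (πK : Integers p K) (s : (Integers p K)⟦X⟧) :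
    (TorsionIntegers p πK)⟦X⟧ :=
  fglSum p ((lubinTateLaw (basicSeries πL)).map ((inclK p πK).comp (integersMap p L K)))
    (torsionPoints p πK)
    (fun z => comp₁ p (s.map (inclK p πK)) (translate p πK z))

/-- The series `[α]_L (s ([πK]_K (x)))`. -/
def endoSide (πL : Integers p L) (πK : Integers p K) (α : Integers p L)
    (s : (Integers p K)⟦X⟧) : (TorsionIntegers p πK)⟦X⟧ :=
  comp₁ p
    ((lubinTateEndo (basicSeries πL) α).map ((inclK p πK).comp (integersMap p L K)))
    (comp₁ p (s.map (inclK p πK)) ((lubinTateEndo (basicSeries πK) πK).map (inclK p πK)))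

/-- The set `𝒜^α_{L,K}` of all `r ∈ 𝒪_K⟦X⟧` with `|r(0)| < 1` and
`∑ r (x ⊕_K z) = [α]_L (r ([πK]_K (x)))`. -/
def interpolating (πL : Integers p L) (πK : Integers p K) (α : Integers p L) :
    Set (Integers p K)⟦X⟧ :=
  {r | πK ∣ PowerSeries.constantCoeff r ∧ traceSum p πL πK r = endoSide p πL πK α r}

end Setting

end ColemanTrace

end

/-!
By Lubin's and Tate's lemma `F_K`, `F_L`, `[π_K]_K` and `[α]_L` exist and are determined by the
conditions which define them. Put `y = [π_K]_K(X) = π X + X ^ q` with `π = π_K` and `q = q_K`. The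
translates `x_z = X ⊕_K z` are the roots of `T ^ q + π T - y`, and the trace of a series is the
value at `(x_z)` of a symmetric power series; it is therefore `D(y)` for a unique `D ∈ 𝒪_K⟦X⟧`, and
the condition on `r` compares `D(X)` with `[α]_L(r(X))`.

The power sums `∑ x_z ^ k` are divisible by `π`, and `∑ x_z ^ (q - 1) = (1 - q) π`. As `q_L ≥ 3`,
the law `F_L` has no terms of degree two, so a change of `r` by a multiple of `π ^ m`, `m ≥ 1`,
changes the trace additively modulo `π ^ (m + 2)`; moreover it changes `[α]_L(r(X))` by a multiple
of `π ^ (m + 2)` since `π ^ 2 ∣ π_L ∣ α`. A defect `π ^ (m + 1) E(y)` is thus removed modulo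
`π ^ (m + 2)` by subtracting `π ^ m X ^ (q - 1) E(y) / (1 - q)` from `r`, and these corrections
converge. Conversely, the defect modulo `π ^ 2` depends on `r` modulo `π` only.
-/

namespace ColemanTrace

open Filter Topology
open scoped nonZeroDivisors

section Order

variable {R : Type*} [CommRing R] {σ τ : Type*}

theorem natCast_le_order_iff {n : ℕ} {φ : MvPowerSeries σ R} :
    (n : ℕ∞) ≤ φ.order ↔ ∀ d : σ →₀ ℕ, d.degree < n → MvPowerSeries.coeff d φ = 0 :=
  ⟨fun h _ hd => MvPowerSeries.coeff_of_lt_order (lt_of_lt_of_le (by exact_mod_cast hd) h),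
    fun h => MvPowerSeries.nat_le_order h⟩

theorem one_le_order {φ : MvPowerSeries σ R} (h : MvPowerSeries.constantCoeff φ = 0) :
    ((1 : ℕ) : ℕ∞) ≤ φ.order := by
  refine natCast_le_order_iff.mpr fun d hd => ?_
  rw [(Finsupp.degree_eq_zero_iff d).mp (Nat.lt_one_iff.mp hd),
    MvPowerSeries.coeff_zero_eq_constantCoeff_apply, h]

theorem exists_eq_single_one_of_degree_eq_one {d : σ →₀ ℕ} (h : d.degree = 1) :
    ∃ i, d = Finsupp.single i 1 := by
  obtain ⟨i, hi⟩ : ∃ i, d i ≠ 0 := by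
    by_contra! h0
    rw [show d = 0 from Finsupp.ext h0, map_zero] at h
    exact zero_ne_one h
  have hle : Finsupp.single i 1 ≤ d := Finsupp.single_le_iff.mpr (Nat.one_le_iff_ne_zero.mpr hi)
  have hdeg := congrArg Finsupp.degree (add_tsub_cancel_of_le hle)
  rw [map_add, Finsupp.degree_single, h, add_eq_left, Finsupp.degree_eq_zero_iff] at hdeg
  exact ⟨i, by rw [← add_tsub_cancel_of_le hle, hdeg, add_zero]⟩

theorem two_le_order {φ : MvPowerSeries σ R} (h0 : MvPowerSeries.constantCoeff φ = 0)
    (h1 : ∀ i, MvPowerSeries.coeff (Finsupp.single i 1) φ = 0) : ((2 : ℕ) : ℕ∞) ≤ φ.order := by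
  refine natCast_le_order_iff.mpr fun d hd => ?_
  rcases Nat.lt_or_ge d.degree 1 with h | h
  · exact natCast_le_order_iff.mp (one_le_order h0) d h
  · obtain ⟨i, rfl⟩ := exists_eq_single_one_of_degree_eq_one (show d.degree = 1 by omega)
    exact h1 i

theorem le_order_add {n : ℕ∞} {φ ψ : MvPowerSeries σ R} (hφ : n ≤ φ.order) (hψ : n ≤ ψ.order) :
    n ≤ (φ + ψ).order :=
  (le_min hφ hψ).trans MvPowerSeries.min_order_le_add

theorem le_order_sub {n : ℕ∞} {φ ψ : MvPowerSeries σ R} (hφ : n ≤ φ.order) (hψ : n ≤ ψ.order) :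
    n ≤ (φ - ψ).order := by
  rw [sub_eq_add_neg]
  exact le_order_add hφ (by rwa [MvPowerSeries.order_neg])

theorem eq_zero_of_forall_natCast_le_order {φ : MvPowerSeries σ R}
    (h : ∀ n : ℕ, (n : ℕ∞) ≤ φ.order) : φ = 0 :=
  MvPowerSeries.ext fun d => natCast_le_order_iff.mp (h (d.degree + 1)) d (Nat.lt_succ_self _)

theorem natCast_le_order_subst {n : ℕ} {a : σ → MvPowerSeries τ R}
    (ha : MvPowerSeries.HasSubst a) (ha0 : ∀ i, MvPowerSeries.constantCoeff (a i) = 0)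
    {φ : MvPowerSeries σ R} (h : (n : ℕ∞) ≤ φ.order) :
    (n : ℕ∞) ≤ (MvPowerSeries.subst a φ).order := by
  refine le_trans ?_ (MvPowerSeries.le_order_subst ha φ)
  calc (n : ℕ∞) = 1 * n := (one_mul _).symm
    _ ≤ _ := mul_le_mul' (le_iInf fun i => by exact_mod_cast one_le_order (ha0 i)) h

theorem succ_le_order_pow_sub_pow {q n : ℕ} (hq : 2 ≤ q) {φ ψ : MvPowerSeries σ R}
    (hφ : MvPowerSeries.constantCoeff φ = 0) (hψ : MvPowerSeries.constantCoeff ψ = 0)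
    (h : (n : ℕ∞) ≤ (φ - ψ).order) : ((n + 1 : ℕ) : ℕ∞) ≤ (φ ^ q - ψ ^ q).order := by
  rw [← geom_sum₂_mul φ ψ q, add_comm n 1, Nat.cast_add]
  refine (add_le_add (one_le_order ?_) h).trans MvPowerSeries.le_order_mul
  rw [map_sum]
  refine Finset.sum_eq_zero fun i hi => ?_
  rw [map_mul, map_pow, map_pow, hφ, hψ]
  rcases Nat.eq_zero_or_pos i with rfl | hi0
  · rw [zero_pow (by omega : q - 1 - 0 ≠ 0), mul_zero]
  · rw [zero_pow hi0.ne', zero_mul]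

theorem exists_forall_le_order_sub {s : ℕ → MvPowerSeries σ R} {k : ℕ}
    (hs : ∀ n : ℕ, ((n + k : ℕ) : ℕ∞) ≤ (s (n + 1) - s n).order) :
    ∃ φ : MvPowerSeries σ R, ∀ n : ℕ, ((n + k : ℕ) : ℕ∞) ≤ (φ - s n).order := by
  have hstable : ∀ d : σ →₀ ℕ, ∀ n m, d.degree < n + k → n ≤ m →
      MvPowerSeries.coeff d (s m) = MvPowerSeries.coeff d (s n) := by
    intro d n m hd hnm
    induction m, hnm using Nat.le_induction with
    | base => rfl
    | succ m hnm ih =>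
      have h := natCast_le_order_iff.mp (hs m) d (by omega)
      rw [map_sub, sub_eq_zero] at h
      rw [h, ih]
  let φ : MvPowerSeries σ R := fun d => MvPowerSeries.coeff d (s (d.degree + 1))
  have hφ : ∀ d, MvPowerSeries.coeff d φ = MvPowerSeries.coeff d (s (d.degree + 1)) :=
    fun _ => rfl
  refine ⟨φ, fun n => natCast_le_order_iff.mpr fun d hd => ?_⟩
  rw [map_sub, hφ, sub_eq_zero]
  rcases le_total n (d.degree + 1) with h | h
  · exact hstable d n _ hd h
  · exact (hstable d _ n (by omega) h).symm

theorem coeff_single_subst [Fintype σ] {g : σ → MvPowerSeries τ R}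
    (hg : ∀ i, MvPowerSeries.constantCoeff (g i) = 0) (φ : MvPowerSeries σ R) (j : τ) :
    MvPowerSeries.coeff (Finsupp.single j 1) (MvPowerSeries.subst g φ) =
      ∑ i, MvPowerSeries.coeff (Finsupp.single i 1) φ *
        MvPowerSeries.coeff (Finsupp.single j 1) (g i) := by
  classical
  have hs := MvPowerSeries.hasSubst_of_constantCoeff_zero hg
  let ψ : MvPowerSeries σ R := MvPowerSeries.C (MvPowerSeries.constantCoeff φ) +
    ∑ i, MvPowerSeries.C (MvPowerSeries.coeff (Finsupp.single i 1) φ) * MvPowerSeries.X i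
  have hψ : ((2 : ℕ) : ℕ∞) ≤ (φ - ψ).order := two_le_order (by simp [ψ]) fun i => by
    simp [ψ, MvPowerSeries.coeff_index_single_X, MvPowerSeries.coeff_C]
  have hlin := natCast_le_order_iff.mp (natCast_le_order_subst hs hg hψ) (Finsupp.single j 1)
    (by simp)
  rw [MvPowerSeries.subst_sub hs, map_sub, sub_eq_zero] at hlin
  have hsubst : MvPowerSeries.subst g ψ = MvPowerSeries.C (MvPowerSeries.constantCoeff φ) +
      ∑ i, MvPowerSeries.C (MvPowerSeries.coeff (Finsupp.single i 1) φ) * g i := by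
    rw [← MvPowerSeries.coe_substAlgHom hs]
    simp only [ψ, map_add, map_sum, map_mul, MvPowerSeries.substAlgHom_X]
    simp only [MvPowerSeries.coe_substAlgHom, MvPowerSeries.subst_C]
  rw [hlin, hsubst]
  simp [MvPowerSeries.coeff_C]

end Order

section CDvd

variable {R : Type*} [CommRing R] {σ : Type*}

theorem C_dvd_iff {a : R} {φ : MvPowerSeries σ R} :
    MvPowerSeries.C a ∣ φ ↔ ∀ d, a ∣ MvPowerSeries.coeff d φ := by
  refine ⟨?_, fun h => ?_⟩
  · rintro ⟨ψ, rfl⟩ d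
    exact ⟨MvPowerSeries.coeff d ψ, MvPowerSeries.coeff_C_mul _ _ _⟩
  · choose c hc using h
    let ψ : MvPowerSeries σ R := c
    exact ⟨ψ, MvPowerSeries.ext fun d => (hc d).trans (MvPowerSeries.coeff_C_mul d ψ a).symm⟩

theorem C_dvd_iff_map_eq_zero {a : R} {φ : MvPowerSeries σ R} :
    MvPowerSeries.C a ∣ φ ↔ MvPowerSeries.map (Ideal.Quotient.mk (Ideal.span {a})) φ = 0 := by
  rw [C_dvd_iff, MvPowerSeries.ext_iff]
  refine forall_congr' fun d => ?_
  rw [MvPowerSeries.coeff_map, MvPowerSeries.coeff_zero, Ideal.Quotient.eq_zero_iff_mem,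
    Ideal.mem_span_singleton]

end CDvd

section LubinTate

variable {R : Type*} [CommRing R] {σ τ : Type*} {π : R} {q : ℕ}

/-- The variables `f(X_i)` for `f(x) = π x + x ^ q`: substituting them into a series `φ` gives
`φ ∘ f`. -/
noncomputable def lubinTateVar (π : R) (q : ℕ) (i : σ) : MvPowerSeries σ R :=
  MvPowerSeries.C π * MvPowerSeries.X i + MvPowerSeries.X i ^ q

/-- The failure `f ∘ φ - φ ∘ f` of a series `φ` in several variables to commute with
`f(x) = π x + x ^ q`. -/
noncomputable def lubinTateDefect (π : R) (q : ℕ) (φ : MvPowerSeries σ R) : MvPowerSeries σ R :=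
  MvPowerSeries.C π * φ + φ ^ q - MvPowerSeries.subst (lubinTateVar π q) φ

/-- The series without constant term which commute with `f(x) = π x + x ^ q`. -/
structure IsLubinTateSeries (π : R) (q : ℕ) (φ : MvPowerSeries σ R) : Prop where
  constantCoeff_eq_zero : MvPowerSeries.constantCoeff φ = 0
  defect_eq_zero : lubinTateDefect π q φ = 0

/-- A uniformizer `π` with residue field of `q` elements, as far as Lubin-Tate theory is concerned:
`R / π` has prime characteristic, of which `q` is a power, and its `q`-Frobenius is the identity. -/
structure IsLubinTatePair (π : R) (q : ℕ) : Prop where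
  mem_nonZeroDivisors : π ∈ R⁰
  mem_jacobson : π ∈ Ideal.jacobson (⊥ : Ideal R)
  exists_eq_prime_pow : ∃ p n, p.Prime ∧ n ≠ 0 ∧ q = p ^ n ∧ CharP (R ⧸ Ideal.span {π}) p
  pow_eq_self : ∀ x : R ⧸ Ideal.span {π}, x ^ q = x

namespace IsLubinTatePair

variable (h : IsLubinTatePair π q)
include h

theorem two_le : 2 ≤ q := by
  obtain ⟨p, n, hp, hn, rfl, -⟩ := h.exists_eq_prime_pow
  exact hp.two_le.trans (Nat.le_self_pow hn p)

theorem ne_zero : q ≠ 0 := by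
  have := h.two_le
  omega

theorem dvd_natCast : π ∣ (q : R) := by
  obtain ⟨p, n, -, hn, rfl, hchar⟩ := h.exists_eq_prime_pow
  have hp0 : ((p : R) : R ⧸ Ideal.span {π}) = 0 := by
    rw [map_natCast, CharP.cast_eq_zero]
  rw [Ideal.Quotient.eq_zero_iff_mem, Ideal.mem_span_singleton] at hp0
  rw [Nat.cast_pow]
  exact hp0.trans (dvd_pow_self _ hn)

theorem isUnit_one_sub {a : R} (ha : π ∣ a) : IsUnit (1 - a) := by
  obtain ⟨b, rfl⟩ := ha
  have := Ideal.mem_jacobson_bot.mp h.mem_jacobson (-b)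
  rwa [mul_neg, neg_add_eq_sub] at this

theorem C_dvd_pow_sub_subst_X_pow (φ : MvPowerSeries σ R) :
    MvPowerSeries.C π ∣ φ ^ q -
      MvPowerSeries.subst (fun i => MvPowerSeries.X i ^ q : σ → MvPowerSeries σ R) φ := by
  obtain ⟨p, n, hp, -, rfl, hchar⟩ := h.exists_eq_prime_pow
  have : ExpChar (R ⧸ Ideal.span {π}) p := ExpChar.prime hp
  have hfrob : iterateFrobenius (R ⧸ Ideal.span {π}) p n = RingHom.id _ :=
    RingHom.ext fun x => (iterateFrobenius_def p n x).trans (h.pow_eq_self x)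
  have hexp := MvPowerSeries.map_iterateFrobenius_expand p hp.ne_zero
    (MvPowerSeries.map (Ideal.Quotient.mk (Ideal.span {π})) φ) n
  rw [hfrob, MvPowerSeries.map_id, RingHom.id_apply, ← MvPowerSeries.map_expand] at hexp
  rw [C_dvd_iff_map_eq_zero, map_sub, map_pow, sub_eq_zero, ← hexp, MvPowerSeries.expand,
    MvPowerSeries.coe_substAlgHom]

end IsLubinTatePair

theorem constantCoeff_lubinTateVar (hq : q ≠ 0) (i : σ) :
    MvPowerSeries.constantCoeff (lubinTateVar π q i) = 0 := by
  simp [lubinTateVar, hq]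

theorem hasSubst_lubinTateVar [Finite σ] (hq : q ≠ 0) :
    MvPowerSeries.HasSubst (lubinTateVar π q : σ → MvPowerSeries σ R) :=
  MvPowerSeries.hasSubst_of_constantCoeff_zero (constantCoeff_lubinTateVar hq)

theorem prod_lubinTateVar_pow (hq : q ≠ 0) (d : σ →₀ ℕ) :
    (d.prod fun i k => lubinTateVar π q i ^ k) = MvPowerSeries.monomial d 1 *
      d.prod fun i k => (MvPowerSeries.C π + MvPowerSeries.X i ^ (q - 1)) ^ k := by
  rw [MvPowerSeries.monomial_one_eq, ← Finsupp.prod_mul]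
  refine Finsupp.prod_congr fun i _ => ?_
  rw [← mul_pow, lubinTateVar, mul_add, mul_pow_sub_one hq, mul_comm (MvPowerSeries.X i)]

theorem coeff_prod_lubinTateVar_pow_self (hq : 2 ≤ q) (d : σ →₀ ℕ) :
    MvPowerSeries.coeff d (d.prod fun i k => lubinTateVar π q i ^ k) = π ^ d.degree := by
  classical
  rw [prod_lubinTateVar_pow (by omega), MvPowerSeries.coeff_monomial_mul, if_pos le_rfl, tsub_self,
    MvPowerSeries.coeff_zero_eq_constantCoeff_apply, map_finsuppProd, one_mul]
  simp only [map_pow, map_add, MvPowerSeries.constantCoeff_C, MvPowerSeries.constantCoeff_X]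
  rw [zero_pow (by omega), add_zero, Finsupp.prod, Finset.prod_pow_eq_pow_sum, Finsupp.degree_apply]

theorem coeff_prod_lubinTateVar_pow_of_degree_le (hq : q ≠ 0) {d e : σ →₀ ℕ}
    (hde : d.degree ≤ e.degree) (hne : e ≠ d) :
    MvPowerSeries.coeff d (e.prod fun i k => lubinTateVar π q i ^ k) = 0 := by
  classical
  rw [prod_lubinTateVar_pow hq, MvPowerSeries.coeff_monomial_mul, if_neg]
  intro hle
  have hdeg := congrArg Finsupp.degree (add_tsub_cancel_of_le hle)
  rw [map_add] at hdeg
  have h0 : d - e = 0 := (Finsupp.degree_eq_zero_iff _).mp (by omega)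
  exact hne (le_antisymm hle (tsub_eq_zero_iff_le.mp h0))

theorem subst_lubinTateVar {g : σ → MvPowerSeries τ R} (hg : MvPowerSeries.HasSubst g) (i : σ) :
    MvPowerSeries.subst g (lubinTateVar π q i) = MvPowerSeries.C π * g i + g i ^ q := by
  rw [lubinTateVar, MvPowerSeries.subst_add hg, MvPowerSeries.subst_mul hg, MvPowerSeries.subst_C,
    MvPowerSeries.subst_pow hg, MvPowerSeries.subst_X hg]

variable [Finite σ]

theorem coeff_subst_lubinTateVar (hq : 2 ≤ q) {φ : MvPowerSeries σ R} {d : σ →₀ ℕ}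
    (h : (d.degree : ℕ∞) ≤ φ.order) :
    MvPowerSeries.coeff d (MvPowerSeries.subst (lubinTateVar π q) φ) =
      π ^ d.degree * MvPowerSeries.coeff d φ := by
  rw [MvPowerSeries.coeff_subst (hasSubst_lubinTateVar (by omega)), finsum_eq_single _ d,
    coeff_prod_lubinTateVar_pow_self hq, smul_eq_mul, mul_comm]
  intro e hne
  rcases lt_or_ge e.degree d.degree with hlt | hge
  · rw [natCast_le_order_iff.mp h e hlt, zero_smul]
  · rw [coeff_prod_lubinTateVar_pow_of_degree_le (by omega) hge hne, smul_zero]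

theorem lubinTateDefect_sub (hq : q ≠ 0) (φ ψ : MvPowerSeries σ R) :
    lubinTateDefect π q φ - lubinTateDefect π q ψ = MvPowerSeries.C π * (φ - ψ) +
      (φ ^ q - ψ ^ q) - MvPowerSeries.subst (lubinTateVar π q) (φ - ψ) := by
  rw [MvPowerSeries.subst_sub (hasSubst_lubinTateVar hq), lubinTateDefect, lubinTateDefect]
  ring

theorem le_order_lubinTateDefect_sub (hq : 2 ≤ q) {n : ℕ} {φ ψ : MvPowerSeries σ R}
    (hφ : MvPowerSeries.constantCoeff φ = 0) (hψ : MvPowerSeries.constantCoeff ψ = 0)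
    (h : (n : ℕ∞) ≤ (φ - ψ).order) :
    (n : ℕ∞) ≤ (lubinTateDefect π q φ - lubinTateDefect π q ψ).order := by
  rw [lubinTateDefect_sub (by omega)]
  refine le_order_sub (le_order_add ?_ ?_) (natCast_le_order_subst
    (hasSubst_lubinTateVar (by omega)) (constantCoeff_lubinTateVar (by omega)) h)
  · rw [← MvPowerSeries.smul_eq_C_mul]
    exact h.trans MvPowerSeries.le_order_smul
  · exact le_trans (by exact_mod_cast n.le_succ) (succ_le_order_pow_sub_pow hq hφ hψ h)

theorem coeff_lubinTateDefect_sub (hq : 2 ≤ q) {φ ψ : MvPowerSeries σ R}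
    (hφ : MvPowerSeries.constantCoeff φ = 0) (hψ : MvPowerSeries.constantCoeff ψ = 0)
    {d : σ →₀ ℕ} (h : (d.degree : ℕ∞) ≤ (φ - ψ).order) :
    MvPowerSeries.coeff d (lubinTateDefect π q φ - lubinTateDefect π q ψ) =
      (π - π ^ d.degree) * MvPowerSeries.coeff d (φ - ψ) := by
  rw [lubinTateDefect_sub (by omega), map_sub, map_add, coeff_subst_lubinTateVar hq h,
    MvPowerSeries.coeff_C_mul,
    natCast_le_order_iff.mp (succ_le_order_pow_sub_pow hq hφ hψ h) d (Nat.lt_succ_self _)]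
  ring

theorem lubinTateDefect_zero (hq : q ≠ 0) : lubinTateDefect π q (0 : MvPowerSeries σ R) = 0 := by
  rw [lubinTateDefect, ← MvPowerSeries.coe_substAlgHom (hasSubst_lubinTateVar hq), map_zero,
    zero_pow hq]
  ring

theorem two_le_order_lubinTateDefect (hq : 2 ≤ q) {φ : MvPowerSeries σ R}
    (hφ : MvPowerSeries.constantCoeff φ = 0) :
    ((2 : ℕ) : ℕ∞) ≤ (lubinTateDefect π q φ).order := by
  have h1 : ((1 : ℕ) : ℕ∞) ≤ (φ - 0).order := by simpa using one_le_order hφ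
  have hq0 : q ≠ 0 := by omega
  rw [← sub_zero (lubinTateDefect π q φ), ← lubinTateDefect_zero (σ := σ) (π := π) hq0]
  refine two_le_order ?_ fun i => ?_
  · exact natCast_le_order_iff.mp (le_order_lubinTateDefect_sub hq hφ (map_zero _) h1) 0 (by simp)
  · rw [coeff_lubinTateDefect_sub hq hφ (map_zero _) (by rwa [Finsupp.degree_single]),
      Finsupp.degree_single, pow_one, sub_self, zero_mul]

theorem IsLubinTateSeries.X (hq : q ≠ 0) (i : σ) :
    IsLubinTateSeries π q (MvPowerSeries.X i : MvPowerSeries σ R) where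
  constantCoeff_eq_zero := MvPowerSeries.constantCoeff_X i
  defect_eq_zero := by
    rw [lubinTateDefect, MvPowerSeries.subst_X (hasSubst_lubinTateVar hq), lubinTateVar, sub_self]

theorem IsLubinTateSeries.zero (hq : q ≠ 0) :
    IsLubinTateSeries π q (0 : MvPowerSeries σ R) :=
  ⟨map_zero _, lubinTateDefect_zero hq⟩

theorem IsLubinTateSeries.lubinTateVar (hq : q ≠ 0) (i : σ) :
    IsLubinTateSeries π q (lubinTateVar π q i) where
  constantCoeff_eq_zero := constantCoeff_lubinTateVar hq i
  defect_eq_zero := by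
    rw [lubinTateDefect, subst_lubinTateVar (hasSubst_lubinTateVar hq), sub_self]

theorem IsLubinTateSeries.subst [Finite τ] (hq : q ≠ 0) {φ : MvPowerSeries σ R}
    (hφ : IsLubinTateSeries π q φ) {g : σ → MvPowerSeries τ R}
    (hg : ∀ i, IsLubinTateSeries π q (g i)) :
    IsLubinTateSeries π q (MvPowerSeries.subst g φ) := by
  have hg0 := fun i => (hg i).constantCoeff_eq_zero
  have hs := MvPowerSeries.hasSubst_of_constantCoeff_zero hg0
  refine ⟨MvPowerSeries.constantCoeff_subst_eq_zero hs hg0 hφ.constantCoeff_eq_zero, ?_⟩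
  have hcomm : (fun i => MvPowerSeries.subst g (ColemanTrace.lubinTateVar π q i)) =
      fun i => MvPowerSeries.subst (ColemanTrace.lubinTateVar π q) (g i) := by
    funext i
    rw [subst_lubinTateVar hs, ← sub_eq_zero]
    exact (hg i).defect_eq_zero
  have hf := congrArg (MvPowerSeries.subst g) hφ.defect_eq_zero
  rw [lubinTateDefect, MvPowerSeries.subst_sub hs, MvPowerSeries.subst_add hs,
    MvPowerSeries.subst_mul hs, MvPowerSeries.subst_C, MvPowerSeries.subst_pow hs,
    MvPowerSeries.subst_comp_subst_apply (hasSubst_lubinTateVar hq) hs, hcomm,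
    ← MvPowerSeries.subst_comp_subst_apply hs (hasSubst_lubinTateVar hq),
    ← MvPowerSeries.coe_substAlgHom hs, map_zero] at hf
  rw [← hf, lubinTateDefect, MvPowerSeries.coe_substAlgHom]

namespace IsLubinTatePair

variable (h : IsLubinTatePair π q)
include h

theorem C_dvd_subst_lubinTateVar_sub (φ : MvPowerSeries σ R) :
    MvPowerSeries.C π ∣ MvPowerSeries.subst (lubinTateVar π q) φ -
      MvPowerSeries.subst (fun i => MvPowerSeries.X i ^ q : σ → MvPowerSeries σ R) φ := by
  have hπ : Ideal.Quotient.mk (Ideal.span {π}) π = 0 :=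
    Ideal.Quotient.eq_zero_iff_mem.mpr (Ideal.mem_span_singleton_self π)
  rw [C_dvd_iff_map_eq_zero, map_sub, MvPowerSeries.map_subst (hasSubst_lubinTateVar h.ne_zero),
    MvPowerSeries.map_subst (MvPowerSeries.HasSubst.X_pow h.ne_zero), sub_eq_zero]
  simp only [lubinTateVar, map_add, map_mul, map_pow, MvPowerSeries.map_C, hπ, map_zero, zero_mul,
    zero_add]

theorem C_dvd_lubinTateDefect (φ : MvPowerSeries σ R) :
    MvPowerSeries.C π ∣ lubinTateDefect π q φ := by
  have hsum := dvd_sub (dvd_add (dvd_mul_right (MvPowerSeries.C π) φ)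
    (h.C_dvd_pow_sub_subst_X_pow φ)) (h.C_dvd_subst_lubinTateVar_sub φ)
  convert hsum using 1
  rw [lubinTateDefect]
  ring

theorem eq_zero_of_sub_pow_mul {n : ℕ} (hn : 2 ≤ n) {a : R} (ha : (π - π ^ n) * a = 0) :
    a = 0 := by
  have hfactor : π - π ^ n = (1 - π ^ (n - 1)) * π := by
    rw [sub_mul, one_mul, pow_sub_one_mul (by omega)]
  rw [hfactor, mul_assoc,
    (h.isUnit_one_sub (dvd_pow_self π (by omega : n - 1 ≠ 0))).mul_right_eq_zero] at ha
  exact mul_left_mem_nonZeroDivisors_eq_zero_iff h.mem_nonZeroDivisors |>.mp ha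

theorem le_order_sub_of_le_order_defect {n : ℕ} {φ ψ : MvPowerSeries σ R}
    (hφ : MvPowerSeries.constantCoeff φ = 0) (hψ : MvPowerSeries.constantCoeff ψ = 0)
    (hlin : ∀ i, MvPowerSeries.coeff (Finsupp.single i 1) φ =
      MvPowerSeries.coeff (Finsupp.single i 1) ψ)
    (hφn : (n : ℕ∞) ≤ (lubinTateDefect π q φ).order)
    (hψn : (n : ℕ∞) ≤ (lubinTateDefect π q ψ).order) : (n : ℕ∞) ≤ (φ - ψ).order := by
  have htwo : ((2 : ℕ) : ℕ∞) ≤ (φ - ψ).order :=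
    two_le_order (by rw [map_sub, hφ, hψ, sub_zero]) fun i => by rw [map_sub, hlin, sub_self]
  rcases Nat.lt_or_ge n 2 with hn | hn
  · exact le_trans (by exact_mod_cast hn.le) htwo
  suffices ∀ m, 2 ≤ m → m ≤ n → (m : ℕ∞) ≤ (φ - ψ).order from this n hn le_rfl
  intro m hm
  induction m, hm using Nat.le_induction with
  | base => exact fun _ => htwo
  | succ m hm ih =>
    intro hmn
    have ih' := ih (by omega)
    refine natCast_le_order_iff.mpr fun d hd => ?_
    rcases Nat.lt_or_ge d.degree m with hlt | hge
    · exact natCast_le_order_iff.mp ih' d hlt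
    · obtain rfl : d.degree = m := by omega
      refine h.eq_zero_of_sub_pow_mul hm ?_
      rw [← coeff_lubinTateDefect_sub h.two_le hφ hψ ih',
        natCast_le_order_iff.mp (le_order_sub hφn hψn) d (by omega)]

theorem eq_of_coeff_single_eq {φ ψ : MvPowerSeries σ R} (hφ : IsLubinTateSeries π q φ)
    (hψ : IsLubinTateSeries π q ψ) (hlin : ∀ i, MvPowerSeries.coeff (Finsupp.single i 1) φ =
      MvPowerSeries.coeff (Finsupp.single i 1) ψ) : φ = ψ := by
  refine sub_eq_zero.mp (eq_zero_of_forall_natCast_le_order fun n =>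
    h.le_order_sub_of_le_order_defect hφ.1 hψ.1 hlin ?_ ?_)
  · rw [hφ.defect_eq_zero, MvPowerSeries.order_zero]
    exact le_top
  · rw [hψ.defect_eq_zero, MvPowerSeries.order_zero]
    exact le_top

theorem exists_succ_le_order_defect {n : ℕ} (hn : 2 ≤ n) {φ : MvPowerSeries σ R}
    (hφ : MvPowerSeries.constantCoeff φ = 0) (hdef : (n : ℕ∞) ≤ (lubinTateDefect π q φ).order) :
    ∃ ψ : MvPowerSeries σ R, MvPowerSeries.constantCoeff ψ = 0 ∧ (n : ℕ∞) ≤ (ψ - φ).order ∧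
      ((n + 1 : ℕ) : ℕ∞) ≤ (lubinTateDefect π q ψ).order := by
  classical
  obtain ⟨e, he⟩ := h.C_dvd_lubinTateDefect φ
  obtain ⟨v, hv⟩ := (h.isUnit_one_sub (dvd_pow_self π (by omega : n - 1 ≠ 0))).exists_right_inv
  -- the correction in degree `n` changes the defect by `(π - π ^ n) c`
  let c : MvPowerSeries σ R := fun d =>
    if d.degree = n then -v * MvPowerSeries.coeff d e else 0
  have hcoeff : ∀ d, MvPowerSeries.coeff d c =
    if d.degree = n then -v * MvPowerSeries.coeff d e else 0 := fun _ => rfl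
  have hc : (n : ℕ∞) ≤ (φ + c - φ).order := by
    rw [add_sub_cancel_left]
    exact natCast_le_order_iff.mpr fun d hd => by rw [hcoeff, if_neg hd.ne]
  have hc0 : MvPowerSeries.constantCoeff (φ + c) = 0 := by
    rw [map_add, hφ, zero_add, ← MvPowerSeries.coeff_zero_eq_constantCoeff_apply, hcoeff,
      if_neg (by rw [map_zero]; omega)]
  refine ⟨φ + c, hc0, hc, natCast_le_order_iff.mpr fun d hd => ?_⟩
  rw [← add_sub_cancel (lubinTateDefect π q φ) (lubinTateDefect π q (φ + c)), map_add]
  rcases Nat.lt_or_ge d.degree n with hlt | hge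
  · rw [natCast_le_order_iff.mp hdef d hlt, natCast_le_order_iff.mp
      (le_order_lubinTateDefect_sub h.two_le hc0 hφ hc) d hlt, add_zero]
  · obtain rfl : d.degree = n := by omega
    rw [coeff_lubinTateDefect_sub h.two_le hc0 hφ hc, add_sub_cancel_left, hcoeff, if_pos rfl, he,
      MvPowerSeries.coeff_C_mul]
    have hfactor : π - π ^ d.degree = π * (1 - π ^ (d.degree - 1)) := by
      rw [mul_sub, mul_one, mul_pow_sub_one (by omega)]
    rw [hfactor]
    linear_combination (-π * MvPowerSeries.coeff d e) * hv

theorem exists_seq_le_order_defect {φ₀ : MvPowerSeries σ R}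
    (hφ₀ : MvPowerSeries.constantCoeff φ₀ = 0) :
    ∃ s : ℕ → MvPowerSeries σ R, s 0 = φ₀ ∧ ∀ n, MvPowerSeries.constantCoeff (s n) = 0 ∧
      ((n + 2 : ℕ) : ℕ∞) ≤ (s (n + 1) - s n).order ∧
      ((n + 2 : ℕ) : ℕ∞) ≤ (lubinTateDefect π q (s n)).order := by
  choose! next hnext using fun n (φ : MvPowerSeries σ R) => h.exists_succ_le_order_defect (n := n)
    (φ := φ)
  let s : ℕ → MvPowerSeries σ R := fun n => Nat.rec φ₀ (fun n φ => next (n + 2) φ) n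
  have hs : ∀ n, MvPowerSeries.constantCoeff (s n) = 0 ∧
      ((n + 2 : ℕ) : ℕ∞) ≤ (lubinTateDefect π q (s n)).order := by
    intro n
    induction n with
    | zero => exact ⟨hφ₀, two_le_order_lubinTateDefect h.two_le hφ₀⟩
    | succ n ih =>
      obtain ⟨h0, -, hdef⟩ := hnext (n + 2) (s n) (by omega) ih.1 ih.2
      exact ⟨h0, hdef⟩
  exact ⟨s, rfl, fun n => ⟨(hs n).1, (hnext (n + 2) (s n) (by omega) (hs n).1 (hs n).2).2.1,
    (hs n).2⟩⟩

theorem exists_isLubinTateSeries (a : σ → R) :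
    ∃ φ : MvPowerSeries σ R, IsLubinTateSeries π q φ ∧
      ∀ i, MvPowerSeries.coeff (Finsupp.single i 1) φ = a i := by
  classical
  have := Fintype.ofFinite σ
  obtain ⟨s, hs0, hs⟩ := h.exists_seq_le_order_defect
    (φ₀ := ∑ i, MvPowerSeries.C (a i) * MvPowerSeries.X i) (by simp)
  obtain ⟨φ, hφs⟩ := exists_forall_le_order_sub fun n => (hs n).2.1
  have hlin : ∀ d : σ →₀ ℕ, d.degree < 2 →
      MvPowerSeries.coeff d φ = MvPowerSeries.coeff d (s 0) := fun d hd => by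
    rw [← sub_eq_zero, ← map_sub, natCast_le_order_iff.mp (hφs 0) d hd]
  have hφ0 : MvPowerSeries.constantCoeff φ = 0 :=
    (hlin 0 (by simp)).trans (hs 0).1
  refine ⟨φ, ⟨hφ0, eq_zero_of_forall_natCast_le_order fun n => ?_⟩, fun i => ?_⟩
  · have hdef := le_order_add
      (le_order_lubinTateDefect_sub (π := π) h.two_le hφ0 (hs n).1 (hφs n)) (hs n).2.2
    rw [sub_add_cancel] at hdef
    exact le_trans (by exact_mod_cast (by omega)) hdef
  · rw [hlin _ (by simp), hs0]
    simp [MvPowerSeries.coeff_index_single_X]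

end IsLubinTatePair

end LubinTate

theorem constantCoeff_vec_two {R τ : Type*} [CommRing R] {a b : MvPowerSeries τ R}
    (ha : MvPowerSeries.constantCoeff a = 0) (hb : MvPowerSeries.constantCoeff b = 0) :
    ∀ i, MvPowerSeries.constantCoeff (![a, b] i) = 0 :=
  Fin.forall_fin_two.mpr ⟨ha, hb⟩

section LubinTateLaw

variable {R : Type*} [CommRing R] {σ τ : Type*} {π : R} {q : ℕ}

theorem coeff_single_subst_pair {a b : MvPowerSeries τ R}
    (ha : MvPowerSeries.constantCoeff a = 0) (hb : MvPowerSeries.constantCoeff b = 0)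
    {F : MvPowerSeries (Fin 2) R}
    (hF : ∀ i, MvPowerSeries.coeff (Finsupp.single i 1) F = 1) (j : τ) :
    MvPowerSeries.coeff (Finsupp.single j 1) (MvPowerSeries.subst ![a, b] F) =
      MvPowerSeries.coeff (Finsupp.single j 1) a + MvPowerSeries.coeff (Finsupp.single j 1) b := by
  rw [coeff_single_subst (constantCoeff_vec_two ha hb),
    Fin.sum_univ_two, hF, hF, one_mul, one_mul]
  rfl

theorem coeff_single_formalGroup (F : FormalGroup R) (i : Fin 2) :
    MvPowerSeries.coeff (Finsupp.single i 1) F.toPowerSeries = 1 := by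
  fin_cases i
  exacts [F.lin_coeff_X, F.lin_coeff_Y]

theorem IsLubinTateSeries.substPair [Finite τ] (hq : q ≠ 0) {F : MvPowerSeries (Fin 2) R}
    (hF : IsLubinTateSeries π q F) {a b : MvPowerSeries τ R} (ha : IsLubinTateSeries π q a)
    (hb : IsLubinTateSeries π q b) : IsLubinTateSeries π q (MvPowerSeries.subst ![a, b] F) :=
  hF.subst hq (Fin.forall_fin_two.mpr ⟨ha, hb⟩)

theorem subst_basicSeries {g : MvPowerSeries τ R} (hg : PowerSeries.HasSubst g) :
    PowerSeries.subst g (basicSeries π) = MvPowerSeries.C π * g + g ^ residueCard π := by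
  rw [basicSeries, PowerSeries.subst_coe hg, basicPoly]
  simp only [map_add, map_mul, map_pow, Polynomial.aeval_X, Polynomial.aeval_C]
  rfl

theorem basicSeries_eq_lubinTateVar (π : R) :
    basicSeries π = lubinTateVar π (residueCard π) () := by
  rw [basicSeries, basicPoly, lubinTateVar]
  simp only [Polynomial.coe_add, Polynomial.coe_mul, Polynomial.coe_C, Polynomial.coe_X,
    Polynomial.coe_pow]
  rfl

theorem isLubinTateLaw_iff (F : FormalGroup R) : IsLubinTateLaw (basicSeries π) F ↔
    IsLubinTateSeries π (residueCard π) F.toPowerSeries := by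
  have hvar : (fun i : Fin 2 => PowerSeries.subst (MvPowerSeries.X i : MvPowerSeries (Fin 2) R)
      (basicSeries π)) = lubinTateVar π (residueCard π) := by
    funext i
    rw [subst_basicSeries (PowerSeries.HasSubst.X i), lubinTateVar]
  rw [IsLubinTateLaw, hvar,
    subst_basicSeries (PowerSeries.HasSubst.of_constantCoeff_zero F.zero_constantCoeff),
    ← sub_eq_zero]
  exact ⟨fun h => ⟨F.zero_constantCoeff, h⟩, fun h => h.defect_eq_zero⟩

theorem isLubinTateEndo_iff (a : R) (φ : R⟦X⟧) : IsLubinTateEndo (basicSeries π) a φ ↔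
    IsLubinTateSeries (σ := Unit) π (residueCard π) φ ∧ PowerSeries.coeff 1 φ = a := by
  have hdefect : MvPowerSeries.constantCoeff φ = 0 →
      (PowerSeries.subst φ (basicSeries π) = PowerSeries.subst (basicSeries π) φ ↔
        lubinTateDefect (σ := Unit) π (residueCard π) φ = 0) := fun h0 => by
    rw [subst_basicSeries (PowerSeries.HasSubst.of_constantCoeff_zero' h0), lubinTateDefect,
      sub_eq_zero, basicSeries_eq_lubinTateVar]
    rfl
  rw [IsLubinTateEndo, PowerSeries.coeff_zero_eq_constantCoeff]
  exact ⟨fun ⟨h0, h1, h⟩ => ⟨⟨h0, (hdefect h0).mp h⟩, h1⟩,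
    fun ⟨h, h1⟩ => ⟨h.1, h1, (hdefect h.1).mpr h.2⟩⟩

section

variable (hπ : IsLubinTatePair π q)
include hπ

theorem IsLubinTatePair.eq_of_coeff_one_eq {φ ψ : R⟦X⟧}
    (hφ : IsLubinTateSeries (σ := Unit) π q φ) (hψ : IsLubinTateSeries (σ := Unit) π q ψ)
    (h : PowerSeries.coeff 1 φ = PowerSeries.coeff 1 ψ) : φ = ψ :=
  hπ.eq_of_coeff_single_eq hφ hψ fun _ => h

theorem IsLubinTatePair.subst_assoc {F : MvPowerSeries (Fin 2) R}
    (hF : IsLubinTateSeries π q F)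
    (hlin : ∀ i, MvPowerSeries.coeff (Finsupp.single i 1) F = 1) [Finite τ]
    {a b c : MvPowerSeries τ R} (ha : IsLubinTateSeries π q a) (hb : IsLubinTateSeries π q b)
    (hc : IsLubinTateSeries π q c) :
    MvPowerSeries.subst ![MvPowerSeries.subst ![a, b] F, c] F =
      MvPowerSeries.subst ![a, MvPowerSeries.subst ![b, c] F] F := by
  have hab := hF.substPair hπ.ne_zero ha hb
  have hbc := hF.substPair hπ.ne_zero hb hc
  refine hπ.eq_of_coeff_single_eq (hF.substPair hπ.ne_zero hab hc)
    (hF.substPair hπ.ne_zero ha hbc) fun i => ?_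
  rw [coeff_single_subst_pair hab.1 hc.1 hlin, coeff_single_subst_pair ha.1 hbc.1 hlin,
    coeff_single_subst_pair ha.1 hb.1 hlin, coeff_single_subst_pair hb.1 hc.1 hlin, add_assoc]

end

variable (hπ : IsLubinTatePair π (residueCard π))
include hπ

theorem exists_isLubinTateLaw : ∃ F, IsLubinTateLaw (basicSeries π) F := by
  obtain ⟨F, hF, hlin⟩ := hπ.exists_isLubinTateSeries (σ := Fin 2) fun _ => 1
  have hX := fun i : Fin 3 => IsLubinTateSeries.X (π := π) hπ.ne_zero i
  exact ⟨⟨F, hF.1, hlin 0, hlin 1, hπ.subst_assoc hF hlin (hX 0) (hX 1) (hX 2)⟩,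
    (isLubinTateLaw_iff _).mpr hF⟩

theorem isLubinTateSeries_lubinTateLaw :
    IsLubinTateSeries π (residueCard π) (lubinTateLaw (basicSeries π)).toPowerSeries := by
  have h := exists_isLubinTateLaw hπ
  rw [lubinTateLaw, dif_pos h]
  exact (isLubinTateLaw_iff _).mp h.choose_spec

theorem isLubinTateEndo_lubinTateEndo (a : R) :
    IsLubinTateEndo (basicSeries π) a (lubinTateEndo (basicSeries π) a) := by
  have h : ∃ φ, IsLubinTateEndo (basicSeries π) a φ := by
    obtain ⟨φ, hφ, hlin⟩ := hπ.exists_isLubinTateSeries (σ := Unit) fun _ => a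
    exact ⟨φ, (isLubinTateEndo_iff a φ).mpr ⟨hφ, hlin ()⟩⟩
  rw [lubinTateEndo, dif_pos h]
  exact h.choose_spec

theorem isLubinTateSeries_lubinTateEndo (a : R) :
    IsLubinTateSeries (σ := Unit) π (residueCard π) (lubinTateEndo (basicSeries π) a) :=
  ((isLubinTateEndo_iff a _).mp (isLubinTateEndo_lubinTateEndo hπ a)).1

theorem coeff_one_lubinTateEndo (a : R) :
    PowerSeries.coeff 1 (lubinTateEndo (basicSeries π) a) = a :=
  (isLubinTateEndo_lubinTateEndo hπ a).2.1

theorem lubinTateEndo_self : lubinTateEndo (basicSeries π) π = basicSeries π := by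
  refine hπ.eq_of_coeff_one_eq (isLubinTateSeries_lubinTateEndo hπ π) ?_ ?_
  · rw [basicSeries_eq_lubinTateVar]
    exact .lubinTateVar hπ.ne_zero ()
  · have hq : 1 ≠ residueCard π := by
      have := hπ.two_le
      omega
    rw [coeff_one_lubinTateEndo hπ, basicSeries, Polynomial.coeff_coe, basicPoly]
    simp [Polynomial.coeff_X_pow, hq]

theorem lubinTateEndo_mul_self (a : R) : lubinTateEndo (basicSeries π) (a * π) =
    PowerSeries.subst (basicSeries π) (lubinTateEndo (basicSeries π) a) := by
  have hf : IsLubinTateSeries (σ := Unit) π (residueCard π) (basicSeries π) :=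
    lubinTateEndo_self hπ ▸ isLubinTateSeries_lubinTateEndo hπ π
  refine hπ.eq_of_coeff_one_eq (isLubinTateSeries_lubinTateEndo hπ _)
    ((isLubinTateSeries_lubinTateEndo hπ a).subst hπ.ne_zero fun _ => hf) ?_
  rw [coeff_one_lubinTateEndo hπ]
  refine ((coeff_single_subst (fun _ => hf.1) _ ()).trans ?_).symm
  rw [Fintype.sum_unique]
  refine congrArg₂ (· * ·) (coeff_one_lubinTateEndo hπ a) ?_
  conv_lhs => rw [← lubinTateEndo_self hπ]
  exact coeff_one_lubinTateEndo hπ π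

theorem isComm_lubinTateLaw : (lubinTateLaw (basicSeries π)).IsComm := by
  have hF := isLubinTateSeries_lubinTateLaw hπ
  have hX := fun i : Fin 2 => IsLubinTateSeries.X (π := π) hπ.ne_zero i
  refine ⟨hπ.eq_of_coeff_single_eq hF (hF.substPair hπ.ne_zero (hX 1) (hX 0)) fun i => ?_⟩
  rw [coeff_single_subst_pair (hX 1).1 (hX 0).1 (coeff_single_formalGroup _),
    coeff_single_formalGroup]
  fin_cases i <;> simp [MvPowerSeries.coeff_index_single_X]

theorem residueCard_le_order_lubinTateLaw_sub : (residueCard π : ℕ∞) ≤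
    ((lubinTateLaw (basicSeries π)).toPowerSeries -
      (MvPowerSeries.X 0 + MvPowerSeries.X 1)).order := by
  have hF := isLubinTateSeries_lubinTateLaw hπ
  refine hπ.le_order_sub_of_le_order_defect hF.1 (by simp) (fun i => ?_) ?_ ?_
  · rw [coeff_single_formalGroup]
    fin_cases i <;> simp [MvPowerSeries.coeff_index_single_X]
  · rw [hF.defect_eq_zero, MvPowerSeries.order_zero]
    exact le_top
  · have hpow : ∀ φ : MvPowerSeries (Fin 2) R, MvPowerSeries.constantCoeff φ = 0 →
        (residueCard π : ℕ∞) ≤ (φ ^ residueCard π).order := fun φ h =>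
      MvPowerSeries.le_order_pow_of_constantCoeff_eq_zero _ h
    have hdefect : lubinTateDefect π (residueCard π)
        (MvPowerSeries.X 0 + MvPowerSeries.X 1 : MvPowerSeries (Fin 2) R) =
        (MvPowerSeries.X 0 + MvPowerSeries.X 1) ^ residueCard π -
        (MvPowerSeries.X 0 ^ residueCard π + MvPowerSeries.X 1 ^ residueCard π) := by
      have hs := hasSubst_lubinTateVar (σ := Fin 2) (π := π) hπ.ne_zero
      rw [lubinTateDefect, MvPowerSeries.subst_add hs, MvPowerSeries.subst_X hs,
        MvPowerSeries.subst_X hs, lubinTateVar, lubinTateVar]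
      ring
    rw [hdefect]
    exact le_order_sub (hpow _ (by simp)) (le_order_add (hpow _ (by simp)) (hpow _ (by simp)))

theorem subst_X_lubinTateEndo_neg_one :
    MvPowerSeries.subst ![PowerSeries.X, lubinTateEndo (basicSeries π) (-1)]
      (lubinTateLaw (basicSeries π)).toPowerSeries = 0 := by
  have hX : IsLubinTateSeries (σ := Unit) π (residueCard π) PowerSeries.X := .X hπ.ne_zero ()
  have hneg := isLubinTateSeries_lubinTateEndo hπ (-1)
  refine hπ.eq_of_coeff_single_eq
    ((isLubinTateSeries_lubinTateLaw hπ).substPair hπ.ne_zero hX hneg) (.zero hπ.ne_zero)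
    fun i => ?_
  rw [coeff_single_subst_pair hX.1 hneg.1 (coeff_single_formalGroup _), map_zero]
  exact (congrArg₂ (· + ·) PowerSeries.coeff_one_X (coeff_one_lubinTateEndo hπ (-1))).trans
    (add_neg_cancel 1)

theorem subst_lubinTateLaw_lubinTateEndo (a : R) :
    PowerSeries.subst (lubinTateLaw (basicSeries π)).toPowerSeries
      (lubinTateEndo (basicSeries π) a) =
    MvPowerSeries.subst (fun i : Fin 2 => PowerSeries.subst
      (MvPowerSeries.X i : MvPowerSeries (Fin 2) R) (lubinTateEndo (basicSeries π) a))
      (lubinTateLaw (basicSeries π)).toPowerSeries := by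
  have hF := isLubinTateSeries_lubinTateLaw hπ
  have hφ := isLubinTateSeries_lubinTateEndo hπ a
  have hφX : ∀ i : Fin 2, IsLubinTateSeries π (residueCard π) (PowerSeries.subst
      (MvPowerSeries.X i : MvPowerSeries (Fin 2) R) (lubinTateEndo (basicSeries π) a)) :=
    fun i => hφ.subst hπ.ne_zero fun _ => .X hπ.ne_zero i
  refine hπ.eq_of_coeff_single_eq (hφ.subst hπ.ne_zero fun _ => hF) (hF.subst hπ.ne_zero hφX)
    fun j => ?_
  rw [coeff_single_subst fun i => (hφX i).1]
  simp only [PowerSeries.subst, coeff_single_subst fun _ => MvPowerSeries.constantCoeff_X _,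
    coeff_single_subst fun _ => hF.1, coeff_single_formalGroup]
  fin_cases j <;> simp [MvPowerSeries.coeff_index_single_X]

end LubinTateLaw

open scoped MvPowerSeries.WithPiTopology

section Evaluation

section

variable {B : Type*} [CommRing B] [TopologicalSpace B] [IsLinearTopology B B]
  {σ : Type*}

theorem hasEval_topologicalNilradical [Finite σ] (g : σ → topologicalNilradical B) :
    MvPowerSeries.HasEval fun i => (g i : B) where
  hpow i := IsTopologicallyNilpotent.mem_topologicalNilradical_iff.mp (g i).2
  tendsto_zero := by
    rw [Filter.cofinite_eq_bot]
    exact tendsto_bot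

theorem mem_topologicalNilradical_of_constantCoeff_eq_zero {f : MvPowerSeries σ B}
    (hf : MvPowerSeries.constantCoeff f = 0) : f ∈ topologicalNilradical (MvPowerSeries σ B) :=
  IsTopologicallyNilpotent.mem_topologicalNilradical_iff.mpr
    (MvPowerSeries.WithPiTopology.isTopologicallyNilpotent_of_constantCoeff_zero hf)

end

variable {R B B' : Type*} [CommRing R] [UniformSpace R] [IsUniformAddGroup R]
  [IsTopologicalRing R]
  [CommRing B] [UniformSpace B] [IsUniformAddGroup B] [IsTopologicalRing B] [IsLinearTopology B B]
  [T2Space B] [CompleteSpace B] [Algebra R B] [ContinuousSMul R B]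
  [CommRing B'] [UniformSpace B'] [IsUniformAddGroup B'] [IsTopologicalRing B']
  [IsLinearTopology B' B'] [T2Space B'] [CompleteSpace B'] [Algebra R B'] [ContinuousSMul R B']
  {σ τ : Type*} [Finite σ]

/-- Evaluation of power series at a point `g` with topologically nilpotent coordinates. -/
noncomputable def evalAt (g : σ → topologicalNilradical B) : MvPowerSeries σ R →A[R] B :=
  ⟨MvPowerSeries.aeval (hasEval_topologicalNilradical g), MvPowerSeries.continuous_aeval _⟩

/-- The map which a continuous homomorphism induces on topologically nilpotent elements. -/
def nilMap (ε : B →A[R] B') (b : topologicalNilradical B) : topologicalNilradical B' :=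
  ⟨ε b, IsTopologicallyNilpotent.mem_topologicalNilradical_iff.mpr
    ((IsTopologicallyNilpotent.mem_topologicalNilradical_iff.mp b.2).map ε.continuous)⟩

theorem hasSum_evalAt (g : σ → topologicalNilradical B) (f : MvPowerSeries σ R) :
    HasSum (fun d : σ →₀ ℕ => MvPowerSeries.coeff d f • d.prod fun i k => (g i : B) ^ k)
      (evalAt g f) :=
  MvPowerSeries.hasSum_aeval _ f

theorem evalAt_coe (g : σ → topologicalNilradical B) (P : MvPolynomial σ R) :
    evalAt g (P : MvPowerSeries σ R) = MvPolynomial.aeval (fun i => (g i : B)) P :=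
  MvPowerSeries.aeval_coe _ P

theorem evalAt_X (g : σ → topologicalNilradical B) (i : σ) :
    evalAt g (MvPowerSeries.X i : MvPowerSeries σ R) = g i := by
  rw [← MvPolynomial.coe_X, evalAt_coe, MvPolynomial.aeval_X]

theorem evalAt_C (g : σ → topologicalNilradical B) (a : R) :
    evalAt g (MvPowerSeries.C a : MvPowerSeries σ R) = algebraMap R B a := by
  rw [← MvPolynomial.coe_C, evalAt_coe, MvPolynomial.aeval_C]

theorem evalAt_sub_evalAt_mem {I : Ideal B} (hI : IsClosed (I : Set B))
    {g g' : σ → topologicalNilradical B} (hg : ∀ i, (g i : B) - g' i ∈ I)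
    (f : MvPowerSeries σ R) : evalAt g f - evalAt g' f ∈ I := by
  refine hI.mem_of_tendsto ((hasSum_evalAt g f).sub (hasSum_evalAt g' f))
    (Eventually.of_forall fun s => I.sum_mem fun d _ => ?_)
  rw [← smul_sub]
  refine I.smul_of_tower_mem _ ?_
  rw [← Ideal.Quotient.eq, map_finsuppProd, map_finsuppProd]
  refine Finsupp.prod_congr fun i _ => ?_
  rw [map_pow, map_pow, Ideal.Quotient.eq.mpr (hg i)]

theorem evalAt_mem_pow {I : Ideal B} {k : ℕ} (hI : IsClosed ((I ^ k : Ideal B) : Set B))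
    {g : σ → topologicalNilradical B} (hg : ∀ i, (g i : B) ∈ I) {f : MvPowerSeries σ R}
    (hf : (k : ℕ∞) ≤ f.order) : evalAt g f ∈ I ^ k := by
  refine hI.mem_of_tendsto (hasSum_evalAt g f)
    (Eventually.of_forall fun s => Ideal.sum_mem _ fun d _ => ?_)
  rcases Nat.lt_or_ge d.degree k with hd | hd
  · rw [natCast_le_order_iff.mp hf d hd, zero_smul]
    exact zero_mem _
  · refine Submodule.smul_of_tower_mem _ _ (Ideal.pow_le_pow_right hd ?_)
    rw [Finsupp.degree_apply, ← Finset.prod_pow_eq_pow_sum]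
    exact Ideal.prod_mem_prod fun i _ => Ideal.pow_mem_pow (hg i) _

theorem evalAt_mem {I : Ideal B} (hI : IsClosed (I : Set B)) {g : σ → topologicalNilradical B}
    (hg : ∀ i, (g i : B) ∈ I) {f : MvPowerSeries σ R} (hf : MvPowerSeries.constantCoeff f = 0) :
    evalAt g f ∈ I := by
  rw [← pow_one I] at hI ⊢
  exact evalAt_mem_pow hI hg (one_le_order hf)

theorem apply_evalAt (ε : B →A[R] B') (g : σ → topologicalNilradical B) (f : MvPowerSeries σ R) :
    ε (evalAt g f) = evalAt (fun i => nilMap ε (g i)) f :=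
  DFunLike.congr_fun (MvPowerSeries.comp_aeval (ε := ε.toAlgHom)
    (hasEval_topologicalNilradical g) ε.continuous) f

variable [IsLinearTopology R R]

/-- The value at `g` of a power series without constant term, as a topologically nilpotent
element. -/
noncomputable def evalNil (g : σ → topologicalNilradical B) (f : MvPowerSeries σ R)
    (hf : MvPowerSeries.constantCoeff f = 0) : topologicalNilradical B :=
  nilMap (R := R) (evalAt g) ⟨f, mem_topologicalNilradical_of_constantCoeff_eq_zero hf⟩

theorem evalNil_zero (g : σ → topologicalNilradical B) :
    evalNil (R := R) g 0 (map_zero _) = 0 :=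
  Subtype.ext (map_zero (evalAt (R := R) g))

theorem apply_evalNil (ε : B →A[R] B') (g : σ → topologicalNilradical B) {f : MvPowerSeries σ R}
    (hf : MvPowerSeries.constantCoeff f = 0) :
    nilMap ε (evalNil g f hf) = evalNil (fun i => nilMap ε (g i)) f hf :=
  Subtype.ext (apply_evalAt ε g f)

theorem evalNil_X (g : σ → topologicalNilradical B) (i : σ) :
    evalNil (R := R) g (MvPowerSeries.X i) (MvPowerSeries.constantCoeff_X i) = g i :=
  Subtype.ext (evalAt_X g i)

theorem subst_eq_evalAt [T2Space R] [CompleteSpace R] {a : σ → MvPowerSeries τ R}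
    (ha : ∀ i, MvPowerSeries.constantCoeff (a i) = 0) (f : MvPowerSeries σ R) :
    MvPowerSeries.subst a f = evalAt (R := R)
      (fun i => ⟨a i, mem_topologicalNilradical_of_constantCoeff_eq_zero (ha i)⟩) f := by
  have hs := MvPowerSeries.hasSubst_of_constantCoeff_zero ha
  refine HasSum.unique (MvPowerSeries.WithPiTopology.hasSum_iff_hasSum_coeff.mpr fun e => ?_)
    (hasSum_evalAt _ f)
  rw [MvPowerSeries.coeff_subst hs, finsum_eq_sum _ (MvPowerSeries.coeff_subst_finite hs f e)]
  exact hasSum_sum_of_ne_finset_zero fun d hd =>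
    Function.notMem_support.mp fun h => hd ((Set.Finite.mem_toFinset _).mpr h)

theorem evalAt_subst [T2Space R] [CompleteSpace R] [Finite τ] {a : σ → MvPowerSeries τ R}
    (ha : ∀ i, MvPowerSeries.constantCoeff (a i) = 0) (g : τ → topologicalNilradical B)
    (f : MvPowerSeries σ R) :
    evalAt g (MvPowerSeries.subst a f) = evalAt (fun i => evalNil g (a i) (ha i)) f := by
  rw [subst_eq_evalAt ha, apply_evalAt]
  rfl

theorem evalNil_subst [T2Space R] [CompleteSpace R] [Finite τ] {a : σ → MvPowerSeries τ R}
    (ha : ∀ i, MvPowerSeries.constantCoeff (a i) = 0) (g : τ → topologicalNilradical B)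
    {f : MvPowerSeries σ R} (hf : MvPowerSeries.constantCoeff f = 0) :
    evalNil g (MvPowerSeries.subst a f) (MvPowerSeries.constantCoeff_subst_eq_zero
      (MvPowerSeries.hasSubst_of_constantCoeff_zero ha) ha hf) =
      evalNil (fun i => evalNil g (a i) (ha i)) f hf :=
  Subtype.ext (evalAt_subst ha g f)

end Evaluation

theorem vec_two_apply {M N : Type*} (f : M → N) (a b : M) :
    (fun i => f (![a, b] i)) = ![f a, f b] := by
  ext i
  fin_cases i <;> rfl

theorem constantCoeff_subst_pair {R τ : Type*} [CommRing R] {F : FormalGroup R}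
    {a b : MvPowerSeries τ R} (ha : MvPowerSeries.constantCoeff a = 0)
    (hb : MvPowerSeries.constantCoeff b = 0) :
    MvPowerSeries.constantCoeff (MvPowerSeries.subst ![a, b] F.toPowerSeries) = 0 :=
  have hab := constantCoeff_vec_two ha hb
  MvPowerSeries.constantCoeff_subst_eq_zero (MvPowerSeries.hasSubst_of_constantCoeff_zero hab) hab
    F.zero_constantCoeff

/-- A formal group law with a formal inverse. -/
class HasInverse {R : Type*} [CommRing R] (F : FormalGroup R) : Prop where
  exists_inverse : ∃ ι : R⟦X⟧, MvPowerSeries.constantCoeff ι = 0 ∧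
    MvPowerSeries.subst ![PowerSeries.X, ι] F.toPowerSeries = 0

/-- The series `φ` without constant term which are endomorphisms of the formal group law `F`:
`φ (F (x, y)) = F (φ (x), φ (y))`. -/
structure IsFormalEndomorphism {R : Type*} [CommRing R] (F : FormalGroup R) (φ : R⟦X⟧) :
    Prop where
  constantCoeff_eq_zero : MvPowerSeries.constantCoeff φ = 0
  subst_eq : PowerSeries.subst F.toPowerSeries φ = MvPowerSeries.subst (fun i : Fin 2 =>
    PowerSeries.subst (MvPowerSeries.X i : MvPowerSeries (Fin 2) R) φ) F.toPowerSeries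

/-- The points of the formal group law `F` in the topologically nilpotent elements of `B`; they are
a group for the addition `F (a, b)`. -/
@[ext]
structure Points {R : Type*} [CommRing R] (F : FormalGroup R) (B : Type*) [CommRing B]
    [TopologicalSpace B] [IsLinearTopology B B] where
  val : topologicalNilradical B

namespace Points

variable {R B B' : Type*} [CommRing R] [UniformSpace R] [IsUniformAddGroup R]
  [IsTopologicalRing R] [IsLinearTopology R R]
  [CommRing B] [UniformSpace B] [IsUniformAddGroup B] [IsTopologicalRing B] [IsLinearTopology B B]
  [T2Space B] [CompleteSpace B] [Algebra R B] [ContinuousSMul R B]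
  [CommRing B'] [UniformSpace B'] [IsUniformAddGroup B'] [IsTopologicalRing B']
  [IsLinearTopology B' B'] [T2Space B'] [CompleteSpace B'] [Algebra R B'] [ContinuousSMul R B']
  {F : FormalGroup R} {τ : Type*} [Finite τ]

noncomputable instance : Add (Points F B) :=
  ⟨fun a b => ⟨evalNil ![a.val, b.val] F.toPowerSeries F.zero_constantCoeff⟩⟩

instance : Zero (Points F B) :=
  ⟨⟨0⟩⟩

theorem val_add (a b : Points F B) :
    (a + b).val = evalNil ![a.val, b.val] F.toPowerSeries F.zero_constantCoeff :=
  rfl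

theorem val_add_sub_val_add_mem {I : Ideal B} (hI : IsClosed (I : Set B)) {a b : Points F B}
    (h : (a.val - b.val : B) ∈ I) (c : Points F B) : ((a + c).val - (b + c).val : B) ∈ I :=
  evalAt_sub_evalAt_mem hI (g := ![a.val, c.val]) (g' := ![b.val, c.val])
    (Fin.forall_fin_two.mpr ⟨h, by simp⟩) F.toPowerSeries

variable [T2Space R] [CompleteSpace R]

theorem evalAt_subst_pair (g : τ → topologicalNilradical B)
    {a b : MvPowerSeries τ R} (ha : MvPowerSeries.constantCoeff a = 0)
    (hb : MvPowerSeries.constantCoeff b = 0) (f : MvPowerSeries (Fin 2) R) :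
    evalAt g (MvPowerSeries.subst ![a, b] f) = evalAt ![evalNil g a ha, evalNil g b hb] f := by
  rw [evalAt_subst (constantCoeff_vec_two ha hb)]
  congr 2
  ext i
  fin_cases i <;> rfl

theorem evalNil_subst_pair (g : τ → topologicalNilradical B)
    {a b : MvPowerSeries τ R} (ha : MvPowerSeries.constantCoeff a = 0)
    (hb : MvPowerSeries.constantCoeff b = 0) :
    evalNil g (MvPowerSeries.subst ![a, b] F.toPowerSeries) (constantCoeff_subst_pair ha hb) =
      evalNil ![evalNil g a ha, evalNil g b hb] F.toPowerSeries F.zero_constantCoeff :=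
  Subtype.ext (evalAt_subst_pair g ha hb _)

protected theorem add_zero (a : Points F B) : a + 0 = a := by
  have h := congrArg (evalAt fun _ : Unit => a.val) F.Xzero_eq_X
  rw [FormalGroup.Xzero, PowerSeries.X,
    evalAt_subst_pair _ (MvPowerSeries.constantCoeff_X ()) (map_zero _), evalNil_zero,
    evalNil_X] at h
  exact Points.ext (Subtype.ext (h.trans (evalAt_X _ ())))

protected theorem zero_add (a : Points F B) : 0 + a = a := by
  have h := congrArg (evalAt fun _ : Unit => a.val) F.zeroX_eq_X
  rw [FormalGroup.zeroX, PowerSeries.X, evalAt_subst_pair _ (map_zero _)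
    (MvPowerSeries.constantCoeff_X ()), evalNil_zero, evalNil_X] at h
  exact Points.ext (Subtype.ext (h.trans (evalAt_X _ ())))

protected theorem add_assoc (a b c : Points F B) : a + b + c = a + (b + c) := by
  have hX (i : Fin 3) := MvPowerSeries.constantCoeff_X (R := R) i
  have h := congrArg (evalAt ![a.val, b.val, c.val]) F.assoc
  rw [evalAt_subst_pair _ (constantCoeff_subst_pair (hX 0) (hX 1)) (hX 2),
    evalAt_subst_pair _ (hX 0) (constantCoeff_subst_pair (hX 1) (hX 2)),
    evalNil_subst_pair _ (hX 0) (hX 1), evalNil_subst_pair _ (hX 1) (hX 2)] at h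
  simp only [evalNil_X] at h
  exact Points.ext (Subtype.ext h)

protected theorem add_comm [F.IsComm] (a b : Points F B) : a + b = b + a := by
  have hX (i : Fin 2) := MvPowerSeries.constantCoeff_X (R := R) i
  have h := congrArg (evalAt ![a.val, b.val]) (FormalGroup.IsComm.comm (F := F))
  rw [evalAt_subst_pair _ (hX 1) (hX 0), evalNil_X, evalNil_X] at h
  exact Points.ext (Subtype.ext h)

theorem add_evalNil_inverse {ι : R⟦X⟧} (h0 : MvPowerSeries.constantCoeff ι = 0)
    (hι : MvPowerSeries.subst ![PowerSeries.X, ι] F.toPowerSeries = 0) (a : Points F B) :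
    a + ⟨evalNil (fun _ => a.val) ι h0⟩ = 0 := by
  have h := congrArg (evalAt fun _ : Unit => a.val) hι
  rw [PowerSeries.X, evalAt_subst_pair _ (MvPowerSeries.constantCoeff_X ()) h0, evalNil_X,
    map_zero] at h
  exact Points.ext (Subtype.ext h)

variable [F.IsComm] [HasInverse F]

noncomputable instance : Neg (Points F B) :=
  ⟨fun a => ⟨evalNil (fun _ : Unit => a.val) _
    (HasInverse.exists_inverse (F := F)).choose_spec.1⟩⟩

noncomputable instance : AddCommGroup (Points F B) where
  add_assoc := Points.add_assoc
  add_zero := Points.add_zero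
  zero_add := Points.zero_add
  add_comm := Points.add_comm
  neg_add_cancel a := (Points.add_comm (-a) a).trans <|
    have hι := (HasInverse.exists_inverse (F := F)).choose_spec
    add_evalNil_inverse hι.1 hι.2 a
  nsmul := nsmulRec
  zsmul := zsmulRec

/-- The homomorphism on points induced by a continuous homomorphism of rings. -/
noncomputable def map (ε : B →A[R] B') : Points F B →+ Points F B' :=
  AddMonoidHom.mk' (fun a => ⟨nilMap ε a.val⟩) fun a b => Points.ext <| by
    rw [val_add, apply_evalNil, vec_two_apply (nilMap ε), val_add]

theorem coe_val_map (ε : B →A[R] B') (a : Points F B) : ((map ε a).val : B') = ε a.val :=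
  rfl

/-- The endomorphism of the points given by an endomorphism of the formal group law. -/
noncomputable def endo {φ : R⟦X⟧} (hφ : IsFormalEndomorphism F φ) :
    Points F B →+ Points F B :=
  AddMonoidHom.mk' (fun a => ⟨evalNil (fun _ => a.val) φ hφ.constantCoeff_eq_zero⟩)
    fun a b => Points.ext <| Subtype.ext <| by
    have hX (i : Fin 2) := MvPowerSeries.constantCoeff_X (R := R) i
    have h := congrArg (evalAt ![a.val, b.val]) hφ.subst_eq
    rw [PowerSeries.subst, evalAt_subst (fun _ => F.zero_constantCoeff), evalAt_subst fun i =>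
      PowerSeries.constantCoeff_subst_eq_zero (hX i) _ hφ.constantCoeff_eq_zero] at h
    refine h.trans (congrArg (fun g => evalAt g F.toPowerSeries) ?_)
    ext i : 1
    refine (evalNil_subst (fun _ => hX i) _ hφ.constantCoeff_eq_zero).trans ?_
    simp only [evalNil_X]
    fin_cases i <;> rfl

/-- The subgroup of the points which lie in a closed ideal. -/
def inIdeal (F : FormalGroup R) [F.IsComm] [HasInverse F] {I : Ideal B}
    (hI : IsClosed (I : Set B)) : AddSubgroup (Points F B) where
  carrier := {a | (a.val : B) ∈ I}
  zero_mem' := I.zero_mem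
  add_mem' {a b} ha hb := evalAt_mem hI (g := ![a.val, b.val])
    (Fin.forall_fin_two.mpr ⟨ha, hb⟩) F.zero_constantCoeff
  neg_mem' {a} ha := evalAt_mem (σ := Unit) hI (g := fun _ => a.val) (fun _ => ha)
    (HasInverse.exists_inverse (F := F)).choose_spec.1

section inIdeal

variable {I : Ideal B} {hI : IsClosed (I : Set B)}

theorem mem_inIdeal {a : Points F B} : a ∈ inIdeal F hI ↔ (a.val : B) ∈ I :=
  Iff.rfl

theorem sub_mem_inIdeal {a b : Points F B} :
    a - b ∈ inIdeal F hI ↔ (a.val - b.val : B) ∈ I := by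
  rw [mem_inIdeal]
  refine ⟨fun h => ?_, fun h => ?_⟩
  · have := val_add_sub_val_add_mem hI (a := a - b) (b := 0) (I.sub_mem h I.zero_mem) b
    rwa [sub_add_cancel, zero_add] at this
  · have := val_add_sub_val_add_mem hI h (-b)
    rw [add_neg_cancel, ← sub_eq_add_neg] at this
    exact (Submodule.sub_mem_iff_left I I.zero_mem).mp this

end inIdeal

end Points

section Trinomial

variable {M ι : Type*} [CommRing M] [IsDomain M] [Fintype ι] {x : ι → M} {q : ℕ} {a y : M}

theorem monic_natDegree_trinomial (hq : 2 ≤ q) (a y : M) :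
    (Polynomial.X ^ q + (Polynomial.C a * Polynomial.X - Polynomial.C y)).Monic ∧
      (Polynomial.X ^ q + (Polynomial.C a * Polynomial.X - Polynomial.C y)).natDegree = q := by
  have hdeg : (Polynomial.C a * Polynomial.X - Polynomial.C y).degree < (q : WithBot ℕ) :=
    (Polynomial.degree_sub_le _ _).trans_lt <| max_lt
      ((Polynomial.degree_C_mul_X_le a).trans_lt (by exact_mod_cast hq))
      (Polynomial.degree_C_le.trans_lt (by exact_mod_cast by omega))
  refine ⟨Polynomial.monic_X_pow_add hdeg, Polynomial.natDegree_eq_of_degree_eq_some ?_⟩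
  rw [Polynomial.degree_add_eq_left_of_degree_lt (by rwa [Polynomial.degree_X_pow]),
    Polynomial.degree_X_pow]

variable (hq : 2 ≤ q) (hcard : Fintype.card ι = q) (hinj : Function.Injective x)
  (hx : ∀ i, x i ^ q + a * x i = y)
include hq hcard hinj hx

theorem prod_X_sub_C_eq_trinomial :
    ((Finset.univ.val.map x).map fun r => (Polynomial.X - Polynomial.C r)).prod =
      Polynomial.X ^ q + (Polynomial.C a * Polynomial.X - Polynomial.C y) := by
  obtain ⟨hmonic, hnat⟩ := monic_natDegree_trinomial hq a y
  have hc : Multiset.card (Finset.univ.val.map x) = q := by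
    rw [Multiset.card_map, Finset.card_val, Finset.card_univ, hcard]
  have hle : Finset.univ.val.map x ≤
      (Polynomial.X ^ q + (Polynomial.C a * Polynomial.X - Polynomial.C y)).roots := by
    rw [Multiset.le_iff_subset ((Multiset.nodup_map_iff_of_injective hinj).mpr Finset.univ.nodup)]
    intro r hr
    obtain ⟨i, -, rfl⟩ := Multiset.mem_map.mp hr
    rw [Polynomial.mem_roots hmonic.ne_zero, Polynomial.IsRoot.def, ← hx i]
    simp only [Polynomial.eval_add, Polynomial.eval_sub, Polynomial.eval_mul,
      Polynomial.eval_pow, Polynomial.eval_X, Polynomial.eval_C]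
    ring
  have hroots := Multiset.eq_of_le_of_card_le hle
    ((Polynomial.card_roots' _).trans (hnat.trans hc.symm).le)
  rw [hroots]
  refine Polynomial.prod_multiset_X_sub_C_of_monic_of_roots_card_eq hmonic ?_
  rw [← hroots, hc, hnat]

theorem aeval_esymm_trinomial {R : Type*} [CommRing R] [Algebra R M] {k : ℕ} (hk : k ≤ q) :
    MvPolynomial.aeval x (MvPolynomial.esymm ι R k) = (-1) ^ k *
      (Polynomial.X ^ q + (Polynomial.C a * Polynomial.X - Polynomial.C y)).coeff (q - k) := by
  have hc : Multiset.card (Finset.univ.val.map x) = q := by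
    rw [Multiset.card_map, Finset.card_val, Finset.card_univ, hcard]
  have h := Multiset.prod_X_sub_C_coeff (Finset.univ.val.map x) (k := q - k) (by omega)
  rw [prod_X_sub_C_eq_trinomial hq hcard hinj hx, hc, Nat.sub_sub_self hk] at h
  rw [MvPolynomial.aeval_esymm_eq_multiset_esymm, h, ← mul_assoc, ← pow_add, ← two_mul,
    pow_mul, neg_one_sq, one_pow, one_mul]

theorem aeval_esymm_trinomial_mem {R : Type*} [CommRing R] [Algebra R M] {S : Subalgebra R M}
    (ha : a ∈ S) (hy : y ∈ S) {k : ℕ} (hk : k ≤ q) :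
    MvPolynomial.aeval x (MvPolynomial.esymm ι R k) ∈ S := by
  rw [aeval_esymm_trinomial hq hcard hinj hx hk]
  refine S.mul_mem (S.pow_mem (S.neg_mem S.one_mem) k) ?_
  simp only [Polynomial.coeff_add, Polynomial.coeff_sub, Polynomial.coeff_X_pow,
    Polynomial.coeff_C_mul, Polynomial.coeff_X, Polynomial.coeff_C]
  refine S.add_mem ?_ (S.sub_mem (S.mul_mem ha ?_) ?_) <;> split_ifs <;>
    first | exact S.one_mem | exact S.zero_mem | exact hy

theorem aeval_esymm_trinomial_eq_zero {k : ℕ} (h0 : 0 < k) (hk : k < q - 1) :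
    MvPolynomial.aeval x (MvPolynomial.esymm ι M k) = 0 := by
  rw [aeval_esymm_trinomial hq hcard hinj hx (by omega)]
  simp only [Polynomial.coeff_add, Polynomial.coeff_sub, Polynomial.coeff_X_pow,
    Polynomial.coeff_C_mul, Polynomial.coeff_X, Polynomial.coeff_C]
  rw [if_neg (by omega), if_neg (by omega), if_neg (by omega)]
  ring

theorem aeval_esymm_trinomial_pred :
    MvPolynomial.aeval x (MvPolynomial.esymm ι M (q - 1)) = (-1) ^ (q - 1) * a := by
  rw [aeval_esymm_trinomial hq hcard hinj hx (by omega)]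
  simp only [Polynomial.coeff_add, Polynomial.coeff_sub, Polynomial.coeff_X_pow,
    Polynomial.coeff_C_mul, Polynomial.coeff_X, Polynomial.coeff_C]
  rw [if_neg (by omega), if_pos (by omega), if_neg (by omega)]
  ring

theorem sum_pow_trinomial {k : ℕ} (h0 : 0 < k) (hk : k < q) :
    ∑ i, x i ^ k = (-1) ^ (k + 1) * k * MvPolynomial.aeval x (MvPolynomial.esymm ι M k) := by
  have h := congrArg (MvPolynomial.aeval x) (MvPolynomial.psum_eq_mul_esymm_sub_sum ι M k h0)
  rw [map_sub, map_sum, Finset.sum_eq_zero, sub_zero] at h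
  · simpa [MvPolynomial.psum] using h
  · intro b hb
    rw [Finset.mem_filter, Finset.HasAntidiagonal.mem_antidiagonal] at hb
    obtain ⟨-, h2, h3⟩ := hb
    rw [map_mul, map_mul, aeval_esymm_trinomial_eq_zero hq hcard hinj hx h2 (by omega)]
    ring

theorem sum_pow_pred_trinomial : ∑ i, x i ^ (q - 1) = (1 - q) * a := by
  obtain ⟨n, rfl⟩ := Nat.exists_eq_add_of_le' (show 1 ≤ q by omega)
  rw [sum_pow_trinomial hq hcard hinj hx (by omega) (by omega),
    aeval_esymm_trinomial_pred hq hcard hinj hx, Nat.add_sub_cancel]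
  have hsign : ((-1 : M) ^ n) * (-1) ^ n = 1 := by
    rw [← pow_add, ← two_mul, pow_mul, neg_one_sq, one_pow]
  push_cast
  linear_combination (-(n : M) * a) * hsign

theorem dvd_sum_pow_trinomial (hdvd : a ∣ q) (k : ℕ) : a ∣ ∑ i, x i ^ k := by
  induction k using Nat.strong_induction_on with
  | _ k ih =>
    rcases Nat.eq_zero_or_pos k with rfl | h0
    · simpa [hcard] using hdvd
    rcases lt_trichotomy k (q - 1) with hk | rfl | hk
    · rw [sum_pow_trinomial hq hcard hinj hx h0 (by omega),
        aeval_esymm_trinomial_eq_zero hq hcard hinj hx h0 hk, mul_zero]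
      exact dvd_zero _
    · rw [sum_pow_pred_trinomial hq hcard hinj hx]
      exact dvd_mul_left _ _
    · obtain ⟨n, rfl⟩ := Nat.exists_eq_add_of_le' (show q ≤ k by omega)
      have hrec : ∑ i, x i ^ (n + q) = y * ∑ i, x i ^ n - a * ∑ i, x i ^ (n + 1) := by
        rw [Finset.mul_sum, Finset.mul_sum, ← Finset.sum_sub_distrib]
        refine Finset.sum_congr rfl fun i _ => ?_
        rw [← hx i]
        ring
      rw [hrec]
      exact dvd_sub ((ih n (by omega)).mul_left _) (dvd_mul_right _ _)

end Trinomial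

section Symmetric

variable {R ι : Type*} [CommRing R]

theorem tendsto_truncTotal [TopologicalSpace R] [Finite ι] (φ : MvPowerSeries ι R) :
    Tendsto (fun n => (MvPowerSeries.truncTotal n φ : MvPowerSeries ι R)) atTop (𝓝 φ) := by
  rw [MvPowerSeries.WithPiTopology.tendsto_iff_coeff_tendsto]
  intro d
  refine tendsto_atTop_of_eventually_const (i₀ := d.degree + 1) fun n hn => ?_
  rw [MvPolynomial.coeff_coe, MvPowerSeries.coeff_truncTotal _ (by omega)]

theorem isSymmetric_truncTotal [Finite ι] {φ : MvPowerSeries ι R}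
    (hφ : ∀ e : Equiv.Perm ι, MvPowerSeries.rename e φ = φ) (n : ℕ) :
    (MvPowerSeries.truncTotal n φ).IsSymmetric := by
  intro e
  ext d
  obtain ⟨c, rfl⟩ : ∃ c, d = Finsupp.mapDomain e c :=
    ⟨d.mapDomain e.symm, by rw [← Finsupp.mapDomain_comp, Equiv.self_comp_symm,
      Finsupp.mapDomain_id]⟩
  have hcoeff : MvPowerSeries.coeff (c.mapDomain e) φ = MvPowerSeries.coeff c φ := by
    have h := MvPowerSeries.coeff_embDomain_rename e.toEmbedding φ c
    rw [Finsupp.embDomain_eq_mapDomain] at h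
    exact (congrArg _ (hφ e).symm).trans h
  rw [MvPolynomial.coeff_rename_mapDomain _ e.injective, MvPowerSeries.coeff_truncTotal_eq_ite,
    MvPowerSeries.coeff_truncTotal_eq_ite, hcoeff, Finsupp.degree_mapDomain]

theorem aeval_mem_of_isSymmetric [Fintype ι] {B : Type*} [CommRing B] [Algebra R B]
    {S : Subalgebra R B} {x : ι → B}
    (hx : ∀ k ≤ Fintype.card ι, MvPolynomial.aeval x (MvPolynomial.esymm ι R k) ∈ S)
    {P : MvPolynomial ι R} (hP : P.IsSymmetric) : MvPolynomial.aeval x P ∈ S := by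
  obtain ⟨Q, hQ⟩ := (MvPolynomial.esymmAlgEquiv ι (R := R) rfl).surjective ⟨P, hP⟩
  have hPQ : P = MvPolynomial.aeval
      (fun i : Fin (Fintype.card ι) => MvPolynomial.esymm ι R (i + 1)) Q := by
    rw [← MvPolynomial.esymmAlgHom_apply]
    exact (congrArg Subtype.val hQ).symm
  rw [hPQ, ← AlgHom.comp_apply, MvPolynomial.comp_aeval]
  have hQ' := AlgHom.mem_range_self (MvPolynomial.aeval (R := R) fun i : Fin (Fintype.card ι) =>
    MvPolynomial.aeval x (MvPolynomial.esymm ι R (i + 1))) Q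
  rw [← Algebra.adjoin_range_eq_range_aeval] at hQ'
  exact Algebra.adjoin_le (Set.range_subset_iff.mpr fun i => hx _ i.2) hQ'

theorem evalAt_mem_of_isSymmetric [Fintype ι] {B : Type*} [UniformSpace R] [IsUniformAddGroup R]
    [IsTopologicalRing R] [CommRing B] [UniformSpace B] [IsUniformAddGroup B]
    [IsTopologicalRing B] [IsLinearTopology B B] [T2Space B] [CompleteSpace B] [Algebra R B]
    [ContinuousSMul R B] {S : Subalgebra R B} (hS : IsClosed (S : Set B))
    {x : ι → topologicalNilradical B} (hx : ∀ k ≤ Fintype.card ι,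
      MvPolynomial.aeval (fun i => (x i : B)) (MvPolynomial.esymm ι R k) ∈ S)
    {φ : MvPowerSeries ι R} (hφ : ∀ e : Equiv.Perm ι, MvPowerSeries.rename e φ = φ) :
    evalAt x φ ∈ S := by
  refine hS.mem_of_tendsto (((evalAt x).continuous.tendsto φ).comp (tendsto_truncTotal φ))
    (Eventually.of_forall fun n => ?_)
  rw [Function.comp_apply, evalAt_coe]
  exact aeval_mem_of_isSymmetric hx (isSymmetric_truncTotal hφ n)

end Symmetric

section SuccessiveApproximation

theorem exists_map_eq_zero_iff {P Q : Type*} [AddCommGroup P] [AddCommGroup Q] (Δ : P →+ Q)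
    {U : ℕ → AddSubgroup P} {V : ℕ → AddSubgroup Q} (hΔ : ∀ n, ∀ a ∈ U n, Δ a ∈ V n)
    (hcorr : ∀ n s, Δ s ∈ V n → ∃ a ∈ U n, Δ (s + a) ∈ V (n + 1))
    (hcomplete : ∀ s : ℕ → P, (∀ n, s (n + 1) - s n ∈ U n) → ∃ r, ∀ n, r - s n ∈ U n)
    (hsep : ∀ b, (∀ n, b ∈ V n) → b = 0) (s : P) :
    (∃ r, Δ r = 0 ∧ r - s ∈ U 0) ↔ Δ s ∈ V 0 := by
  refine ⟨fun ⟨r, hr, hrs⟩ => ?_, fun hs => ?_⟩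
  · have h := hΔ 0 _ hrs
    rwa [map_sub, hr, zero_sub, neg_mem_iff] at h
  · choose! a ha haV using hcorr
    let t : ℕ → P := fun n => n.rec s fun n t => t + a n t
    have ht : ∀ n, Δ (t n) ∈ V n := fun n => n.rec hs fun n ih => haV n _ ih
    obtain ⟨r, hr⟩ := hcomplete t fun n => by
      change t n + a n (t n) - t n ∈ U n
      rw [add_sub_cancel_left]
      exact ha n _ (ht n)
    refine ⟨r, hsep _ fun n => ?_, hr 0⟩
    rw [← sub_add_cancel r (t n), map_add]
    exact add_mem (hΔ n _ (hr n)) (ht n)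

end SuccessiveApproximation

section Compact

theorem isClosed_span_singleton {B : Type*} [CommRing B] [TopologicalSpace B] [ContinuousMul B]
    [T2Space B] [CompactSpace B] (c : B) : IsClosed (Ideal.span {c} : Set B) := by
  have h : (Ideal.span {c} : Set B) = Set.range fun b => b * c := by
    ext b
    exact Ideal.mem_span_singleton'
  rw [h]
  exact (isCompact_range (continuous_mul_const c)).isClosed

theorem exists_forall_pow_dvd_sub {B : Type*} [CommRing B] [TopologicalSpace B]
    [IsTopologicalRing B] [T2Space B] [CompactSpace B] {c : B} {s : ℕ → B}
    (hs : ∀ n, c ^ (n + 1) ∣ s (n + 1) - s n) : ∃ r, ∀ n, c ^ (n + 1) ∣ r - s n := by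
  let t : ℕ → Set B := fun n => {r | c ^ (n + 1) ∣ r - s n}
  have hclosed : ∀ n, IsClosed (t n) := fun n => by
    have h : t n = (fun r => r - s n) ⁻¹' (Ideal.span {c ^ (n + 1)} : Set B) := by
      ext r
      exact Ideal.mem_span_singleton.symm
    rw [h]
    exact (isClosed_span_singleton _).preimage (by fun_prop)
  obtain ⟨r, hr⟩ := IsCompact.nonempty_iInter_of_sequence_nonempty_isCompact_isClosed t
    (fun n r hr => by
      have h := dvd_add ((pow_dvd_pow c n.succ.le_succ).trans hr) (hs n)
      rwa [sub_add_sub_cancel] at h)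
    (fun n => ⟨s n, by simp [t]⟩) (hclosed 0).isCompact hclosed
  exact ⟨r, Set.mem_iInter.mp hr⟩

theorem eq_zero_of_forall_pow_dvd {B : Type*} [CommRing B] [TopologicalSpace B]
    [IsLinearTopology B B] [T2Space B] {c : B} (hc : IsTopologicallyNilpotent c) {b : B}
    (hb : ∀ n, c ^ n ∣ b) : b = 0 := by
  choose e he using hb
  have h := IsLinearTopology.tendsto_mul_zero_of_left _ e hc
  exact tendsto_nhds_unique tendsto_const_nhds (h.congr fun n => (he n).symm)

instance {σ B : Type*} [TopologicalSpace B] [CompactSpace B] :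
    CompactSpace (MvPowerSeries σ B) :=
  inferInstanceAs (CompactSpace ((σ →₀ ℕ) → B))

end Compact

namespace Points

variable {R B B' : Type*} [CommRing R] [UniformSpace R] [IsUniformAddGroup R]
  [IsTopologicalRing R] [IsLinearTopology R R] [T2Space R] [CompleteSpace R]
  [CommRing B] [UniformSpace B] [IsUniformAddGroup B] [IsTopologicalRing B] [IsLinearTopology B B]
  [T2Space B] [CompactSpace B] [Algebra R B] [ContinuousSMul R B]
  [CommRing B'] [UniformSpace B'] [IsUniformAddGroup B'] [IsTopologicalRing B']
  [IsLinearTopology B' B'] [T2Space B'] [CompactSpace B'] [Algebra R B'] [ContinuousSMul R B']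
  {F : FormalGroup R} [F.IsComm] [HasInverse F] {π : R}

/-- The subgroup of the points which are divisible by `π ^ n`. -/
noncomputable def level (F : FormalGroup R) [F.IsComm] [HasInverse F] (B : Type*) [CommRing B]
    [UniformSpace B] [IsUniformAddGroup B] [IsTopologicalRing B] [IsLinearTopology B B]
    [T2Space B] [CompactSpace B] [Algebra R B] [ContinuousSMul R B] (π : R) (n : ℕ) :
    AddSubgroup (Points F B) :=
  inIdeal F (isClosed_span_singleton (algebraMap R B π ^ n))

theorem mem_level {n : ℕ} {a : Points F B} :
    a ∈ level F B π n ↔ algebraMap R B π ^ n ∣ (a.val : B) :=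
  mem_inIdeal.trans Ideal.mem_span_singleton

theorem sub_mem_level {n : ℕ} {a b : Points F B} :
    a - b ∈ level F B π n ↔ algebraMap R B π ^ n ∣ (a.val - b.val : B) :=
  sub_mem_inIdeal.trans Ideal.mem_span_singleton

theorem level_antitone : Antitone (level F B π) := fun _ _ hmn _ ha =>
  mem_level.mpr ((pow_dvd_pow _ hmn).trans (mem_level.mp ha))

theorem map_mem_level (ε : B →A[R] B') {n : ℕ} {a : Points F B} (ha : a ∈ level F B π n) :
    map ε a ∈ level F B' π n := by
  have h := map_dvd ε (mem_level.mp ha)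
  rw [map_pow, AlgHomClass.commutes] at h
  exact mem_level.mpr h

theorem pow_dvd_val_add_sub {k n : ℕ}
    (hF : (k : ℕ∞) ≤ (F.toPowerSeries - (MvPowerSeries.X 0 + MvPowerSeries.X 1)).order)
    {a b : Points F B} (ha : a ∈ level F B π n) (hb : b ∈ level F B π n) :
    algebraMap R B π ^ (n * k) ∣ ((a + b).val - (a.val + b.val) : B) := by
  have hI : Ideal.span {algebraMap R B π ^ n} ^ k = Ideal.span {algebraMap R B π ^ (n * k)} := by
    rw [Ideal.span_singleton_pow, pow_mul]
  have h := evalAt_mem_pow (hI ▸ isClosed_span_singleton _) (g := ![a.val, b.val])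
    (Fin.forall_fin_two.mpr ⟨ha, hb⟩) hF
  rw [hI, Ideal.mem_span_singleton, map_sub, map_add, evalAt_X, evalAt_X] at h
  exact h

theorem pow_dvd_val_sum_sub {k n : ℕ}
    (hF : (k : ℕ∞) ≤ (F.toPowerSeries - (MvPowerSeries.X 0 + MvPowerSeries.X 1)).order)
    {ι : Type*} (s : Finset ι) {a : ι → Points F B} (ha : ∀ i, a i ∈ level F B π n) :
    algebraMap R B π ^ (n * k) ∣ ((∑ i ∈ s, a i).val - ∑ i ∈ s, ((a i).val : B) : B) := by
  induction s using Finset.cons_induction with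
  | empty => exact (sub_self (0 : B)).symm ▸ dvd_zero _
  | cons i s his ih =>
    rw [Finset.sum_cons, Finset.sum_cons]
    have h := dvd_add (pow_dvd_val_add_sub hF (ha i)
      (sum_mem fun j _ => ha j : ∑ j ∈ s, a j ∈ level F B π n)) ih
    convert h using 1
    ring

theorem exists_forall_sub_mem_level {s : ℕ → Points F B}
    (hπ : IsTopologicallyNilpotent (algebraMap R B π))
    (hs : ∀ n, s (n + 1) - s n ∈ level F B π (n + 1)) :
    ∃ r, ∀ n, r - s n ∈ level F B π (n + 1) := by
  obtain ⟨r, hr⟩ := exists_forall_pow_dvd_sub (s := fun n => ((s n).val : B))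
    fun n => sub_mem_level.mp (hs n)
  have hnil : r ∈ topologicalNilradical B := by
    obtain ⟨e, he⟩ := hr 0
    rw [sub_eq_iff_eq_add.mp he, zero_add, pow_one]
    exact add_mem (Ideal.mul_mem_right _ _
      (IsTopologicallyNilpotent.mem_topologicalNilradical_iff.mpr hπ)) (s 0).val.2
  exact ⟨⟨⟨r, hnil⟩⟩, fun n => sub_mem_level.mpr (hr n)⟩

theorem eq_zero_of_forall_mem_level (hπ : IsTopologicallyNilpotent (algebraMap R B π))
    {a : Points F B} (ha : ∀ n, a ∈ level F B π n) : a = 0 :=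
  Points.ext <| Subtype.ext <| eq_zero_of_forall_pow_dvd hπ fun n => mem_level.mp (ha n)

end Points

section LubinTatePoint

variable {R B : Type*} [CommRing R] [UniformSpace R] [IsUniformAddGroup R]
  [IsTopologicalRing R]
  [CommRing B] [UniformSpace B] [IsUniformAddGroup B] [IsTopologicalRing B] [IsLinearTopology B B]
  [T2Space B] [CompleteSpace B] [Algebra R B] [ContinuousSMul R B] {σ : Type*} [Finite σ]
  {π : R} {q : ℕ}

theorem evalAt_lubinTateVar (g : σ → topologicalNilradical B) (i : σ) :
    evalAt g (lubinTateVar π q i) = algebraMap R B π * g i + (g i : B) ^ q := by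
  rw [lubinTateVar, map_add, map_mul, map_pow, evalAt_C, evalAt_X]

variable [IsLinearTopology R R]

/-- The value `[π] (b) = π b + b ^ q` at a topologically nilpotent element `b`. -/
noncomputable def lubinTatePoint (π : R) (hq : q ≠ 0) (b : topologicalNilradical B) :
    topologicalNilradical B :=
  evalNil (fun _ : Unit => b) (lubinTateVar π q ()) (constantCoeff_lubinTateVar hq ())

theorem coe_lubinTatePoint (hq : q ≠ 0) (b : topologicalNilradical B) :
    (lubinTatePoint π hq b : B) = algebraMap R B π * b + (b : B) ^ q :=
  evalAt_lubinTateVar _ ()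

variable [T2Space R] [CompleteSpace R]

theorem evalAt_subst_lubinTateVar (hq : q ≠ 0) (g : σ → topologicalNilradical B)
    (f : MvPowerSeries σ R) : evalAt g (MvPowerSeries.subst (lubinTateVar π q) f) =
      evalAt (fun i => lubinTatePoint π hq (g i)) f := by
  rw [evalAt_subst fun i => constantCoeff_lubinTateVar hq i]
  congr 2
  ext i
  exact (evalAt_lubinTateVar g i).trans (coe_lubinTatePoint hq (g i)).symm

theorem IsLubinTateSeries.lubinTatePoint_evalNil {f : MvPowerSeries σ R}
    (hf : IsLubinTateSeries π q f) (hq : q ≠ 0) (g : σ → topologicalNilradical B) :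
    lubinTatePoint π hq (evalNil g f hf.1) =
      evalNil (fun i => lubinTatePoint π hq (g i)) f hf.1 := by
  have h := congrArg (evalAt g) hf.defect_eq_zero
  rw [lubinTateDefect, map_sub, map_add, map_mul, map_pow, evalAt_C, map_zero, sub_eq_zero,
    evalAt_subst_lubinTateVar hq] at h
  exact Subtype.ext ((coe_lubinTatePoint hq _).trans h)

end LubinTatePoint

section Shift

variable {R A : Type*} [CommRing R] [UniformSpace R] [IsUniformAddGroup R]
  [IsTopologicalRing R] [IsLinearTopology R R]
  [CommRing A] [UniformSpace A] [IsUniformAddGroup A] [IsTopologicalRing A] [IsLinearTopology A A]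
  [T2Space A] [CompleteSpace A] [Algebra R A] [ContinuousSMul R A] {σ : Type*}

/-- The variable `X` as a topologically nilpotent power series. -/
noncomputable def nilX (i : σ) : topologicalNilradical (MvPowerSeries σ A) :=
  ⟨MvPowerSeries.X i, mem_topologicalNilradical_of_constantCoeff_eq_zero
    (MvPowerSeries.constantCoeff_X i)⟩

/-- A topologically nilpotent constant as a topologically nilpotent power series. -/
noncomputable def nilC (a : topologicalNilradical A) : topologicalNilradical A⟦X⟧ :=
  ⟨PowerSeries.C (a : A), IsTopologicallyNilpotent.mem_topologicalNilradical_iff.mpr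
    ((IsTopologicallyNilpotent.mem_topologicalNilradical_iff.mp a.2).map (φ := PowerSeries.C)
      MvPowerSeries.WithPiTopology.continuous_C)⟩

variable (R A) in
/-- The constant coefficient as a continuous homomorphism of algebras. -/
noncomputable def constantCoeffHom : A⟦X⟧ →A[R] A :=
  ⟨{ PowerSeries.constantCoeff with
      commutes' := fun _ => PowerSeries.constantCoeff_C _ },
    MvPowerSeries.WithPiTopology.continuous_constantCoeff A⟩

/-- The translate `F (X, a)` of the variable by a point `a` of the formal group law. -/
noncomputable def shift (F : FormalGroup R) (a : topologicalNilradical A) :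
    topologicalNilradical A⟦X⟧ :=
  evalNil ![nilX (), nilC a] F.toPowerSeries F.zero_constantCoeff

variable [T2Space R] [CompleteSpace R] {F : FormalGroup R}

theorem constantCoeff_shift (F : FormalGroup R) (a : topologicalNilradical A) :
    PowerSeries.constantCoeff (shift F a : A⟦X⟧) = a := by
  have h : nilMap (constantCoeffHom R A) (shift F a) = a := by
    rw [shift, apply_evalNil, vec_two_apply (nilMap (constantCoeffHom R A)),
      show nilMap (constantCoeffHom R A) (nilX ()) = 0 from
        Subtype.ext (PowerSeries.constantCoeff_X),
      show nilMap (constantCoeffHom R A) (nilC a) = a from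
        Subtype.ext (PowerSeries.constantCoeff_C _)]
    exact congrArg Points.val (Points.zero_add (F := F) ⟨a⟩)
  exact congrArg Subtype.val h

theorem lubinTatePoint_shift {π : R} {q : ℕ} (hF : IsLubinTateSeries π q F.toPowerSeries)
    (hq : q ≠ 0) {a : topologicalNilradical A}
    (ha : algebraMap R A π * a + (a : A) ^ q = 0) :
    lubinTatePoint π hq (shift F a) = lubinTatePoint π hq (nilX ()) := by
  have hC : lubinTatePoint π hq (nilC a) = 0 := by
    ext1
    refine (coe_lubinTatePoint hq _).trans (Eq.trans ?_ (map_zero (PowerSeries.C (R := A))))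
    rw [← ha, map_add, map_mul, map_pow, MvPowerSeries.algebraMap_apply]
    rfl
  refine (hF.lubinTatePoint_evalNil (B := A⟦X⟧) hq _).trans ?_
  rw [vec_two_apply (lubinTatePoint (B := A⟦X⟧) π hq), hC]
  exact congrArg Points.val (Points.add_zero (⟨lubinTatePoint π hq (nilX ())⟩ : Points F A⟦X⟧))

end Shift

section Symmetrization

variable {R B ι : Type*} [CommRing R] [UniformSpace R] [IsUniformAddGroup R]
  [IsTopologicalRing R]
  [CommRing B] [UniformSpace B] [IsUniformAddGroup B] [IsTopologicalRing B] [IsLinearTopology B B]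
  [T2Space B] [CompleteSpace B] [Algebra R B] [ContinuousSMul R B] [Fintype ι]

theorem dvd_sum_evalAt {c : B} (hc : IsClosed (Ideal.span {c} : Set B))
    {x : ι → topologicalNilradical B} (hx : ∀ k, c ∣ ∑ i, (x i : B) ^ k) (e : R⟦X⟧) :
    c ∣ ∑ i, evalAt (fun _ : Unit => x i) e := by
  rw [← Ideal.mem_span_singleton]
  refine hc.mem_of_tendsto (hasSum_sum fun i _ => hasSum_evalAt (fun _ : Unit => x i) e)
    (Eventually.of_forall fun s => Ideal.sum_mem _ fun d _ => ?_)
  rw [← Finset.smul_sum]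
  refine Submodule.smul_of_tower_mem _ _ (Ideal.mem_span_singleton.mpr ?_)
  simpa [Finsupp.prod_fintype] using hx (d ())

variable [IsLinearTopology R R]

theorem nilMap_evalAt_nilX {σ : Type*} [Finite σ] (g : σ → topologicalNilradical B) (i : σ) :
    nilMap (R := R) (evalAt g) (nilX i) = g i :=
  Subtype.ext (evalAt_X g i)

variable [T2Space R] [CompleteSpace R] {G : FormalGroup R} [G.IsComm] [HasInverse G]

theorem Points.map_map_evalAt {σ B' : Type*} [Finite σ] [CommRing B'] [UniformSpace B']
    [IsUniformAddGroup B'] [IsTopologicalRing B'] [IsLinearTopology B' B'] [T2Space B']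
    [CompleteSpace B'] [Algebra R B'] [ContinuousSMul R B'] (ε : B →A[R] B')
    (g : σ → topologicalNilradical B) (s : Points G (MvPowerSeries σ R)) :
    Points.map ε (Points.map (evalAt g) s) = Points.map (evalAt fun i => nilMap ε (g i)) s :=
  Points.ext <| Subtype.ext <| apply_evalAt ε g _

/-- The sum of the copies of `s` in all the variables `X i`. -/
noncomputable def symmetrization (ι : Type*) [Fintype ι] (s : Points G R⟦X⟧) :
    Points G (MvPowerSeries ι R) :=
  ∑ i, Points.map (evalAt fun _ : Unit => nilX i) s

theorem map_evalAt_symmetrization (x : ι → topologicalNilradical B) (s : Points G R⟦X⟧) :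
    Points.map (evalAt x) (symmetrization ι s) =
      ∑ i, Points.map (evalAt fun _ : Unit => x i) s := by
  rw [symmetrization, map_sum]
  refine Finset.sum_congr rfl fun i _ => ?_
  rw [← nilMap_evalAt_nilX (R := R) x i]
  exact Points.map_map_evalAt (evalAt x) (fun _ : Unit => nilX i) s

theorem rename_symmetrization (s : Points G R⟦X⟧) (e : Equiv.Perm ι) :
    MvPowerSeries.rename e ((symmetrization ι s).val : MvPowerSeries ι R) =
      (symmetrization ι s).val := by
  have h : Points.map (evalAt (B := MvPowerSeries ι R) fun i => nilX (e i))
      (symmetrization ι s) = symmetrization ι s := by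
    rw [map_evalAt_symmetrization]
    exact Equiv.sum_comp e fun i =>
      Points.map (evalAt (B := MvPowerSeries ι R) fun _ : Unit => nilX i) s
  rw [MvPowerSeries.rename_eq_subst, subst_eq_evalAt (a := MvPowerSeries.X ∘ e)
    fun i => MvPowerSeries.constantCoeff_X (e i)]
  exact congrArg (fun a => (Points.val a : MvPowerSeries ι R)) h

theorem val_sum_map_evalAt_mem {S : Subalgebra R B} (hS : IsClosed (S : Set B))
    {x : ι → topologicalNilradical B} (hx : ∀ k ≤ Fintype.card ι,
      MvPolynomial.aeval (fun i => (x i : B)) (MvPolynomial.esymm ι R k) ∈ S)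
    (s : Points G R⟦X⟧) :
    ((∑ i, Points.map (evalAt fun _ : Unit => x i) s).val : B) ∈ S := by
  rw [← map_evalAt_symmetrization]
  exact evalAt_mem_of_isSymmetric hS hx (rename_symmetrization s)

end Symmetrization

theorem IsLubinTatePair.C_dvd_of_C_dvd_subst_lubinTateVar {R : Type*} [CommRing R] {π : R} {q : ℕ}
    (h : IsLubinTatePair π q) {E : R⟦X⟧}
    (hE : MvPowerSeries.C π ∣ MvPowerSeries.subst (lubinTateVar π q) E) :
    MvPowerSeries.C π ∣ E := by
  have hX := (dvd_sub_right hE).mp (h.C_dvd_subst_lubinTateVar_sub E)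
  refine C_dvd_iff.mpr fun d => ?_
  have hd := C_dvd_iff.mp hX (Finsupp.single () (q * d ()))
  have hcoeff := PowerSeries.coeff_subst_X_pow (S := R) h.ne_zero E (q * d ())
  rw [if_pos (dvd_mul_right _ _), Nat.mul_div_cancel_left _ (Nat.pos_of_ne_zero h.ne_zero)]
    at hcoeff
  have hd' := hd.trans (dvd_of_eq hcoeff)
  rw [Finsupp.unique_single d]
  exact hd'

section Pullback

variable {R A : Type*} [CommRing R] [UniformSpace R] [IsUniformAddGroup R]
  [IsTopologicalRing R]
  [CommRing A] [UniformSpace A] [IsUniformAddGroup A] [IsTopologicalRing A] [IsLinearTopology A A]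
  [T2Space A] [CompleteSpace A] [Algebra R A] [ContinuousSMul R A] {π : R} {q : ℕ}

theorem evalAt_nilX {σ : Type*} [Finite σ] (f : MvPowerSeries σ R) :
    evalAt (B := MvPowerSeries σ A) nilX f = MvPowerSeries.map (algebraMap R A) f := by
  refine HasSum.unique (hasSum_evalAt (B := MvPowerSeries σ A) nilX f) ?_
  have hd (d : σ →₀ ℕ) : MvPowerSeries.coeff d f • d.prod (fun i k =>
      (MvPowerSeries.X i : MvPowerSeries σ A) ^ k) = MvPowerSeries.monomial d
        (MvPowerSeries.coeff d (MvPowerSeries.map (algebraMap R A) f)) := by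
    rw [MvPowerSeries.coeff_map, MvPowerSeries.monomial_eq', Algebra.smul_def,
      MvPowerSeries.algebraMap_apply]
  exact (MvPowerSeries.WithPiTopology.hasSum_of_monomials_self _).congr_fun hd

variable [IsLinearTopology R R]

variable (A) in
/-- The substitution `E ↦ E (π X + X ^ q)`. -/
noncomputable def pullback (π : R) (hq : q ≠ 0) : R⟦X⟧ →A[R] A⟦X⟧ :=
  evalAt fun _ : Unit => lubinTatePoint π hq (nilX ())

variable [T2Space R] [CompleteSpace R]

theorem pullback_apply (hq : q ≠ 0) (E : R⟦X⟧) : pullback A π hq E =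
    MvPowerSeries.map (algebraMap R A) (MvPowerSeries.subst (lubinTateVar π q) E) := by
  rw [← evalAt_nilX]
  exact (evalAt_subst_lubinTateVar (B := A⟦X⟧) hq nilX E).symm

theorem pow_dvd_of_pow_dvd_pullback [IsDomain A] (h : IsLubinTatePair π q)
    (hπ : algebraMap R A π ≠ 0) (hrefl : ∀ a, algebraMap R A π ∣ algebraMap R A a → π ∣ a)
    (n : ℕ) {E : R⟦X⟧}
    (hE : algebraMap R A⟦X⟧ π ^ n ∣ pullback A π h.ne_zero E) : algebraMap R R⟦X⟧ π ^ n ∣ E := by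
  have hC : algebraMap R A⟦X⟧ π = MvPowerSeries.C (algebraMap R A π) :=
    MvPowerSeries.algebraMap_apply
  have hC0 : algebraMap R A⟦X⟧ π ≠ 0 := by
    rw [hC]
    exact fun h0 => hπ (MvPowerSeries.C_injective (h0.trans (map_zero _).symm))
  induction n generalizing E with
  | zero => exact one_dvd _
  | succ n ih =>
    obtain ⟨E', rfl⟩ : algebraMap R R⟦X⟧ π ∣ E := by
      refine h.C_dvd_of_C_dvd_subst_lubinTateVar (C_dvd_iff.mpr fun d => hrefl _ ?_)
      have hdvd := (dvd_pow_self _ n.succ_ne_zero).trans hE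
      rw [hC, pullback_apply] at hdvd
      exact C_dvd_iff.mp hdvd d
    rw [map_mul, AlgHomClass.commutes, pow_succ'] at hE
    rw [pow_succ']
    exact mul_dvd_mul_left _ (ih ((mul_dvd_mul_iff_left hC0).mp hE))

section Compact

variable [IsDomain A] (h : IsLubinTatePair π q) (hπ : algebraMap R A π ≠ 0)
  (hrefl : ∀ a, algebraMap R A π ∣ algebraMap R A a → π ∣ a)
  (hnil : IsTopologicallyNilpotent (algebraMap R R⟦X⟧ π))
include hπ hrefl hnil

theorem pullback_injective : Function.Injective (pullback A π h.ne_zero) := by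
  rw [injective_iff_map_eq_zero]
  intro E hE
  exact eq_zero_of_forall_pow_dvd hnil fun n =>
    pow_dvd_of_pow_dvd_pullback h hπ hrefl n (hE ▸ dvd_zero _)

variable [CompactSpace R]

theorem isClosedEmbedding_pullback : IsClosedEmbedding (pullback A π h.ne_zero) :=
  (pullback A π h.ne_zero).continuous.isClosedEmbedding (pullback_injective h hπ hrefl hnil)

theorem mem_topologicalNilradical_of_pullback_mem {E : R⟦X⟧}
    (hE : pullback A π h.ne_zero E ∈ topologicalNilradical A⟦X⟧) :
    E ∈ topologicalNilradical R⟦X⟧ := by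
  rw [IsTopologicallyNilpotent.mem_topologicalNilradical_iff, IsTopologicallyNilpotent] at hE ⊢
  rw [(isClosedEmbedding_pullback h hπ hrefl hnil).isInducing.tendsto_nhds_iff, map_zero]
  exact hE.congr fun n => (map_pow _ E n).symm

end Compact

end Pullback

section TorsionFamily

variable {R A ι : Type*} [CommRing R] [CommRing A] [TopologicalSpace A] [IsLinearTopology A A]
  [Algebra R A] [Fintype ι] {π : R} {q : ℕ}

/-- The family `z` lists the `q` roots of `π T + T ^ q`, without repetition. -/
structure IsTorsionFamily (π : R) (q : ℕ) (z : ι → topologicalNilradical A) : Prop where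
  card_eq : Fintype.card ι = q
  injective : Function.Injective z
  root : ∀ i, algebraMap R A π * z i + (z i : A) ^ q = 0

theorem IsTorsionFamily.algebraMap_ne_zero [IsDomain A] {z : ι → topologicalNilradical A}
    (hz : IsTorsionFamily π q z) (hq : 2 ≤ q) : algebraMap R A π ≠ 0 := by
  intro h0
  have hzero (i : ι) : z i = 0 := by
    have h := hz.root i
    rw [h0, zero_mul, zero_add] at h
    exact Subtype.ext (eq_zero_of_pow_eq_zero h)
  have hle : Fintype.card ι ≤ 1 := Fintype.card_le_one_iff.mpr fun i j =>
    hz.injective ((hzero i).trans (hzero j).symm)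
  rw [hz.card_eq] at hle
  omega

end TorsionFamily

section Trace

variable {R A ι : Type*} [CommRing R] [UniformSpace R] [IsUniformAddGroup R]
  [IsTopologicalRing R] [IsLinearTopology R R] [T2Space R] [CompleteSpace R]
  [CommRing A] [UniformSpace A] [IsUniformAddGroup A] [IsTopologicalRing A] [IsLinearTopology A A]
  [T2Space A] [CompleteSpace A] [Algebra R A] [ContinuousSMul R A] [Fintype ι] {π : R} {q : ℕ}
  {F G : FormalGroup R} {z : ι → topologicalNilradical A}

theorem IsTorsionFamily.coe_shift_injective (hz : IsTorsionFamily π q z) (F : FormalGroup R) :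
    Function.Injective fun i => (shift F (z i) : A⟦X⟧) := fun i j hij => hz.injective <|
  Subtype.ext <| by
    rw [← constantCoeff_shift F (z i), ← constantCoeff_shift F (z j)]
    exact congrArg _ hij

theorem IsTorsionFamily.shift_pow_add (hz : IsTorsionFamily π q z)
    (hF : IsLubinTateSeries π q F.toPowerSeries) (hq : q ≠ 0) (i : ι) :
    (shift F (z i) : A⟦X⟧) ^ q + algebraMap R A⟦X⟧ π * (shift F (z i) : A⟦X⟧) =
      (lubinTatePoint (B := A⟦X⟧) π hq (nilX ()) : A⟦X⟧) :=
  (add_comm _ _).trans <| (coe_lubinTatePoint (B := A⟦X⟧) hq _).symm.trans <|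
    congrArg Subtype.val (lubinTatePoint_shift hF hq (hz.root i))

variable [G.IsComm] [HasInverse G]

/-- The trace `∑ s (F (X, z i))`, the sum being taken in the formal group law `G`. -/
noncomputable def trace (F G : FormalGroup R) [G.IsComm] [HasInverse G]
    (z : ι → topologicalNilradical A) : Points G R⟦X⟧ →+ Points G A⟦X⟧ :=
  ∑ i, Points.map (evalAt fun _ : Unit => shift F (z i))

theorem trace_apply (s : Points G R⟦X⟧) :
    trace F G z s = ∑ i, Points.map (evalAt fun _ : Unit => shift F (z i)) s :=
  AddMonoidHom.finsetSum_apply _ _ _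

variable (h : IsLubinTatePair π q) (hF : IsLubinTateSeries π q F.toPowerSeries)
  (hz : IsTorsionFamily π q z)
include h hF hz

theorem evalAt_shift_subst_lubinTateVar (i : ι) (e : R⟦X⟧) :
    evalAt (fun _ : Unit => shift F (z i)) (MvPowerSeries.subst (lubinTateVar π q) e) =
      pullback A π h.ne_zero e := by
  refine (evalAt_subst_lubinTateVar (B := A⟦X⟧) h.ne_zero _ e).trans ?_
  rw [pullback, lubinTatePoint_shift hF h.ne_zero (hz.root i)]

variable [IsDomain A]

theorem dvd_sum_evalAt_shift [CompactSpace A] (e : R⟦X⟧) :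
    algebraMap R A⟦X⟧ π ∣ ∑ i, evalAt (fun _ : Unit => shift F (z i)) e := by
  refine dvd_sum_evalAt (isClosed_span_singleton _) (dvd_sum_pow_trinomial h.two_le hz.card_eq
    (hz.coe_shift_injective F) (hz.shift_pow_add hF h.ne_zero) ?_) e
  exact_mod_cast map_dvd (algebraMap R A⟦X⟧) h.dvd_natCast

theorem sum_shift_pow_pred :
    ∑ i, (shift F (z i) : A⟦X⟧) ^ (q - 1) = (1 - q) * algebraMap R A⟦X⟧ π :=
  sum_pow_pred_trinomial h.two_le hz.card_eq (hz.coe_shift_injective F)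
    (hz.shift_pow_add hF h.ne_zero)

theorem trace_mem_range_map_pullback [CompactSpace R]
    (hrefl : ∀ a, algebraMap R A π ∣ algebraMap R A a → π ∣ a)
    (hnil : IsTopologicallyNilpotent (algebraMap R R⟦X⟧ π)) (s : Points G R⟦X⟧) :
    trace F G z s ∈ (Points.map (F := G) (pullback A π h.ne_zero)).range := by
  have hπ := hz.algebraMap_ne_zero h.two_le
  have hclosed := (isClosedEmbedding_pullback h hπ hrefl hnil).isClosed_range
  obtain ⟨E, hE⟩ : ((trace F G z s).val : A⟦X⟧) ∈
      (pullback A π h.ne_zero : R⟦X⟧ →ₐ[R] A⟦X⟧).range := by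
    rw [trace_apply]
    refine val_sum_map_evalAt_mem hclosed (fun k hk => ?_) s
    exact aeval_esymm_trinomial_mem h.two_le hz.card_eq (hz.coe_shift_injective F)
      (hz.shift_pow_add hF h.ne_zero) (Subalgebra.algebraMap_mem _ _)
      ((AlgHom.mem_range _).mpr ⟨MvPowerSeries.X (), evalAt_X (B := A⟦X⟧) _ ()⟩)
      (hk.trans_eq hz.card_eq)
  have hE' : E ∈ topologicalNilradical R⟦X⟧ :=
    mem_topologicalNilradical_of_pullback_mem h hπ hrefl hnil (hE.symm ▸ Subtype.property _)
  exact ⟨⟨⟨E, hE'⟩⟩, Points.ext (Subtype.ext hE)⟩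

end Trace

section Lifting

variable {R A ι : Type*} [CommRing R] [UniformSpace R] [IsUniformAddGroup R]
  [IsTopologicalRing R] [IsLinearTopology R R] [T2Space R] [CompactSpace R]
  [CommRing A] [UniformSpace A] [IsUniformAddGroup A] [IsTopologicalRing A] [IsLinearTopology A A]
  [T2Space A] [CompactSpace A] [Algebra R A] [ContinuousSMul R A] [Fintype ι] {π : R} {q : ℕ}
  {F G : FormalGroup R} [G.IsComm] [HasInverse G] {z : ι → topologicalNilradical A}

theorem Points.exists_val_eq_pow_mul (hnil : IsTopologicallyNilpotent (algebraMap R A π)) {m : ℕ}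
    (hm : 1 ≤ m) (e : A) : ∃ a ∈ level G A π m, (a.val : A) = algebraMap R A π ^ m * e :=
  ⟨⟨⟨_, Ideal.mul_mem_right e _ (Ideal.pow_mem_of_mem _
    (IsTopologicallyNilpotent.mem_topologicalNilradical_iff.mpr hnil) m hm)⟩⟩,
    mem_level.mpr (dvd_mul_right _ _), rfl⟩

theorem pow_dvd_val_trace_sub {k m : ℕ}
    (hG : (k : ℕ∞) ≤ (G.toPowerSeries - (MvPowerSeries.X 0 + MvPowerSeries.X 1)).order)
    {s : Points G R⟦X⟧} {e : R⟦X⟧} (hs : (s.val : R⟦X⟧) = algebraMap R R⟦X⟧ π ^ m * e) :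
    algebraMap R A⟦X⟧ π ^ (m * k) ∣ ((trace F G z s).val : A⟦X⟧) -
      algebraMap R A⟦X⟧ π ^ m * ∑ i, evalAt (fun _ : Unit => shift F (z i)) e := by
  have hmem : s ∈ Points.level G R⟦X⟧ π m := Points.mem_level.mpr (hs ▸ dvd_mul_right _ _)
  have h := Points.pow_dvd_val_sum_sub hG Finset.univ fun i =>
    Points.map_mem_level (evalAt (B := A⟦X⟧) fun _ : Unit => shift F (z i)) hmem
  rw [← trace_apply] at h
  convert h using 2
  rw [Finset.mul_sum]
  refine Finset.sum_congr rfl fun i _ => ?_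
  have hval := congrArg (evalAt (B := A⟦X⟧) fun _ : Unit => shift F (z i)) hs
  rw [map_mul, map_pow, AlgHomClass.commutes] at hval
  exact hval.symm

variable [IsDomain A] (h : IsLubinTatePair π q) (hF : IsLubinTateSeries π q F.toPowerSeries)
  (hz : IsTorsionFamily π q z)
include h hF hz

theorem trace_mem_level_succ
    (hG : ((2 : ℕ) : ℕ∞) ≤ (G.toPowerSeries - (MvPowerSeries.X 0 + MvPowerSeries.X 1)).order)
    {m : ℕ} (hm : 1 ≤ m) {s : Points G R⟦X⟧} (hs : s ∈ Points.level G R⟦X⟧ π m) :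
    trace F G z s ∈ Points.level G A⟦X⟧ π (m + 1) := by
  obtain ⟨e, he⟩ := Points.mem_level.mp hs
  have hsum := mul_dvd_mul_left (algebraMap R A⟦X⟧ π ^ m) (dvd_sum_evalAt_shift h hF hz e)
  rw [← pow_succ] at hsum
  refine Points.mem_level.mpr ((dvd_sub_left hsum).mp ?_)
  exact (pow_dvd_pow _ (by omega)).trans (pow_dvd_val_trace_sub hG he)

/-- The power sum `∑ x i ^ (q - 1) = (1 - q) π` makes the trace of `- X ^ (q - 1) e (y)` cancel
`π e (y)`, up to the unit `1 - q`. -/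
theorem exists_sum_evalAt_shift_eq (e : R⟦X⟧) : ∃ c : R⟦X⟧,
    ∑ i, evalAt (fun _ : Unit => shift F (z i)) c =
      -(algebraMap R A⟦X⟧ π * pullback A π h.ne_zero e) := by
  obtain ⟨u, hu⟩ := (h.isUnit_one_sub h.dvd_natCast).exists_right_inv
  refine ⟨-(algebraMap R R⟦X⟧ u * MvPowerSeries.X () ^ (q - 1) *
    MvPowerSeries.subst (lubinTateVar π q) e), ?_⟩
  have hterm (i : ι) : evalAt (fun _ : Unit => shift F (z i)) (-(algebraMap R R⟦X⟧ u *
      MvPowerSeries.X () ^ (q - 1) * MvPowerSeries.subst (lubinTateVar π q) e)) =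
      (shift F (z i) : A⟦X⟧) ^ (q - 1) *
        -(algebraMap R A⟦X⟧ u * pullback A π h.ne_zero e) := by
    rw [map_neg, map_mul, map_mul, map_pow, AlgHomClass.commutes, evalAt_X,
      evalAt_shift_subst_lubinTateVar h hF hz]
    ring
  have hu' := congrArg (algebraMap R A⟦X⟧) hu
  rw [map_mul, map_sub, map_one, map_natCast] at hu'
  rw [Finset.sum_congr rfl fun i _ => hterm i, ← Finset.sum_mul, sum_shift_pow_pred h hF hz]
  linear_combination (-(algebraMap R A⟦X⟧ π * pullback A π h.ne_zero e)) * hu'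

theorem exists_add_trace_mem_level
    (hG : ((3 : ℕ) : ℕ∞) ≤ (G.toPowerSeries - (MvPowerSeries.X 0 + MvPowerSeries.X 1)).order)
    (hrefl : ∀ a, algebraMap R A π ∣ algebraMap R A a → π ∣ a)
    (hnil : IsTopologicallyNilpotent (algebraMap R R⟦X⟧ π)) {m : ℕ} (hm : 1 ≤ m)
    {E : Points G R⟦X⟧}
    (hE : Points.map (pullback A π h.ne_zero) E ∈ Points.level G A⟦X⟧ π (m + 1)) :
    ∃ a ∈ Points.level G R⟦X⟧ π m,
      Points.map (pullback A π h.ne_zero) E + trace F G z a ∈ Points.level G A⟦X⟧ π (m + 2) := by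
  have hdvd := Points.mem_level.mp hE
  rw [Points.coe_val_map] at hdvd
  obtain ⟨e, he⟩ :=
    pow_dvd_of_pow_dvd_pullback h (hz.algebraMap_ne_zero h.two_le) hrefl _ hdvd
  obtain ⟨c, hc⟩ := exists_sum_evalAt_shift_eq h hF hz e
  obtain ⟨a, ha, hac⟩ := Points.exists_val_eq_pow_mul (G := G) hnil hm c
  refine ⟨a, ha, Points.mem_level.mpr ?_⟩
  obtain ⟨d, hd⟩ := pow_dvd_val_trace_sub (F := F) (z := z) hG hac
  obtain ⟨d', hd'⟩ := Points.pow_dvd_val_add_sub hG (Points.level_antitone m.le_succ hE)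
    (Points.level_antitone m.le_succ (trace_mem_level_succ h hF hz
      ((Nat.cast_le.mpr (by norm_num)).trans hG) hm ha))
  have hval := Points.coe_val_map (pullback A π h.ne_zero) E
  rw [he, map_mul, map_pow, AlgHomClass.commutes] at hval
  refine (pow_dvd_pow _ (by omega : m + 2 ≤ m * 3)).trans ?_
  exact ⟨d + d', by linear_combination hd + hd' + hval + algebraMap R A⟦X⟧ π ^ m * hc⟩

theorem exists_trace_eq_iff
    (hG : ((3 : ℕ) : ℕ∞) ≤ (G.toPowerSeries - (MvPowerSeries.X 0 + MvPowerSeries.X 1)).order)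
    (hrefl : ∀ a, algebraMap R A π ∣ algebraMap R A a → π ∣ a)
    (hnil : IsTopologicallyNilpotent π) {Φ : Points G R⟦X⟧ →+ Points G R⟦X⟧}
    (hΦ : ∀ m, 1 ≤ m → ∀ a ∈ Points.level G R⟦X⟧ π m, Φ a ∈ Points.level G R⟦X⟧ π (m + 2))
    (s : Points G R⟦X⟧) :
    (∃ r, trace F G z r = Points.map (pullback A π h.ne_zero) (Φ r) ∧
        r - s ∈ Points.level G R⟦X⟧ π 1) ↔
      trace F G z s - Points.map (pullback A π h.ne_zero) (Φ s) ∈ Points.level G A⟦X⟧ π 2 := by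
  have hG' := (Nat.cast_le.mpr (by norm_num : 2 ≤ 3)).trans hG
  have hnilR : IsTopologicallyNilpotent (algebraMap R R⟦X⟧ π) :=
    hnil.map (φ := algebraMap R R⟦X⟧) (continuous_algebraMap R R⟦X⟧)
  have hnilA : IsTopologicallyNilpotent (algebraMap R A⟦X⟧ π) :=
    hnil.map (φ := algebraMap R A⟦X⟧) (continuous_algebraMap R A⟦X⟧)
  have hpull (m : ℕ) (hm : 1 ≤ m) (a) (ha : a ∈ Points.level G R⟦X⟧ π m) :
      Points.map (pullback A π h.ne_zero) (Φ a) ∈ Points.level G A⟦X⟧ π (m + 2) :=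
    Points.map_mem_level _ (hΦ m hm a ha)
  have hmain := exists_map_eq_zero_iff
    (trace F G z - (Points.map (F := G) (pullback A π h.ne_zero)).comp Φ)
    (U := fun n => Points.level G R⟦X⟧ π (n + 1)) (V := fun n => Points.level G A⟦X⟧ π (n + 2))
    (fun n a ha => sub_mem (trace_mem_level_succ h hF hz hG' (by omega) ha)
      (Points.level_antitone (by omega) (hpull _ (by omega) a ha)))
    (fun n s hs => ?_) (fun s hs => Points.exists_forall_sub_mem_level hnilR hs)
    (fun b hb => Points.eq_zero_of_forall_mem_level hnilA fun n =>
      Points.level_antitone (by omega) (hb n)) s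
  · simpa only [AddMonoidHom.sub_apply, AddMonoidHom.comp_apply, sub_eq_zero] using hmain
  · obtain ⟨D, hD⟩ := trace_mem_range_map_pullback h hF hz hrefl hnilR s
    rw [AddMonoidHom.sub_apply, ← hD, AddMonoidHom.comp_apply, ← map_sub] at hs
    obtain ⟨a, ha, hEa⟩ := exists_add_trace_mem_level h hF hz hG hrefl hnilR (by omega) hs
    refine ⟨a, ha, ?_⟩
    have hsub := sub_mem hEa (hpull _ (by omega) a ha)
    rw [map_sub, hD] at hsub
    convert hsub using 1
    rw [AddMonoidHom.sub_apply, AddMonoidHom.comp_apply, map_add, map_add, map_add]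
    abel

end Lifting

section Raising

variable {R B : Type*} [CommRing R] [UniformSpace R] [IsUniformAddGroup R]
  [IsTopologicalRing R] [IsLinearTopology R R] [T2Space R] [CompleteSpace R]
  [CommRing B] [UniformSpace B] [IsUniformAddGroup B] [IsTopologicalRing B] [IsLinearTopology B B]
  [T2Space B] [CompactSpace B] [Algebra R B] [ContinuousSMul R B] {π ϖ : R} {q : ℕ}
  {G : FormalGroup R} [G.IsComm] [HasInverse G]

theorem Points.endo_mem_level_add_two {φ ψ : R⟦X⟧} (hφ : IsFormalEndomorphism G φ)
    (hψ : MvPowerSeries.constantCoeff ψ = 0)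
    (hφψ : φ = PowerSeries.C ϖ * ψ + ψ ^ q) (hϖ : π ^ 2 ∣ ϖ) (hq : 3 ≤ q) {m : ℕ} (hm : 1 ≤ m)
    {a : Points G B} (ha : a ∈ level G B π m) : endo hφ a ∈ level G B π (m + 2) := by
  have hψa : algebraMap R B π ^ m ∣ evalAt (fun _ : Unit => a.val) ψ :=
    Ideal.mem_span_singleton.mp (evalAt_mem (isClosed_span_singleton _)
      (fun _ => Ideal.mem_span_singleton.mpr (mem_level.mp ha)) hψ)
  have hval : ((endo hφ a).val : B) = algebraMap R B ϖ * evalAt (fun _ : Unit => a.val) ψ +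
      evalAt (fun _ : Unit => a.val) ψ ^ q := by
    rw [← evalAt_C (fun _ : Unit => a.val), ← map_mul, ← map_pow, ← map_add]
    exact congrArg (evalAt fun _ : Unit => a.val) hφψ
  rw [mem_level, hval]
  refine dvd_add ?_ ?_
  · rw [add_comm m, pow_add, ← map_pow]
    exact mul_dvd_mul (map_dvd _ hϖ) hψa
  · have hpow := pow_dvd_pow_of_dvd hψa q
    rw [← pow_mul] at hpow
    exact (pow_dvd_pow _ (by nlinarith)).trans hpow

end Raising

section Integers

variable (p : ℕ) [Fact p.Prime]

instance : IsDiscreteValuationRing (PadicInt.subring p) :=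
  inferInstanceAs (IsDiscreteValuationRing ℤ_[p])

instance : IsFractionRing (PadicInt.subring p) ℚ_[p] :=
  inferInstanceAs (IsFractionRing ℤ_[p] ℚ_[p])

variable (F : Type*) [Field F] [Algebra ℚ_[p] F]

theorem natCast_integers_ne_zero : (p : Integers p F) ≠ 0 := fun h => by
  have := charZero_of_injective_algebraMap (algebraMap ℚ_[p] F).injective
  have h1 := congrArg Subtype.val h
  rw [Subalgebra.coe_zero, SubringClass.coe_natCast] at h1
  exact (Fact.out : p.Prime).ne_zero (Nat.cast_eq_zero.mp h1)

variable {F} in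
theorem mem_integers_iff [FiniteDimensional ℚ_[p] F] (x : F) :
    x ∈ Integers p F ↔ spectralNorm ℚ_[p] F x ≤ 1 := by
  have hx : IsIntegral ℚ_[p] x := Algebra.IsIntegral.isIntegral x
  rw [spectralNorm, spectralValue_le_one_iff (minpoly.monic hx)]
  constructor
  · intro h n
    have h1 := minpoly.isIntegrallyClosed_eq_field_fractions ℚ_[p] F
      (R := PadicInt.subring p) (S := F) (s := x) h
    rw [Algebra.algebraMap_self, RingHom.id_apply] at h1
    rw [h1, Polynomial.coeff_map]
    exact ((minpoly (PadicInt.subring p) x).coeff n).2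
  · intro h
    have hl : minpoly ℚ_[p] x ∈ Polynomial.lifts (algebraMap (PadicInt.subring p) ℚ_[p]) := by
      rw [Polynomial.lifts_iff_coeff_lifts]
      exact fun n => ⟨⟨_, h n⟩, rfl⟩
    obtain ⟨P, hP, -, hPm⟩ := Polynomial.lifts_and_natDegree_eq_and_monic hl (minpoly.monic hx)
    refine ⟨P, hPm, ?_⟩
    have h2 := minpoly.aeval ℚ_[p] x
    rw [← hP, Polynomial.aeval_map_algebraMap] at h2
    exact h2

variable [FiniteDimensional ℚ_[p] F]

instance : Module.Finite (PadicInt.subring p) (Integers p F) :=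
  IsIntegralClosure.finite (PadicInt.subring p) ℚ_[p] F (Integers p F)

instance : IsDedekindDomain (Integers p F) :=
  integralClosure.isDedekindDomain (PadicInt.subring p) ℚ_[p] F

variable {F} in
theorem isUnit_integers_iff (x : Integers p F) :
    IsUnit x ↔ spectralNorm ℚ_[p] F x.1 = 1 := by
  constructor
  · rintro ⟨u, rfl⟩
    have h : spectralNorm ℚ_[p] F (u.1.1 * (u⁻¹).1.1) =
        spectralNorm ℚ_[p] F u.1.1 * spectralNorm ℚ_[p] F (u⁻¹).1.1 := spectralAlgNorm_mul _ _
    have h1 : (u : Integers p F).1 * (↑u⁻¹ : Integers p F).1 = 1 := by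
      rw [← Subalgebra.coe_mul, Units.mul_inv, Subalgebra.coe_one]
    rw [h1, spectralNorm_one] at h
    have h2 := (mem_integers_iff p _).mp (u : Integers p F).2
    have h3 := (mem_integers_iff p _).mp (↑u⁻¹ : Integers p F).2
    nlinarith [spectralNorm_nonneg (K := ℚ_[p]) (u : Integers p F).1,
      spectralNorm_nonneg (K := ℚ_[p]) (↑u⁻¹ : Integers p F).1]
  · intro h
    have h0 : x.1 ≠ 0 := by
      intro h0
      rw [h0, spectralNorm_zero] at h
      exact zero_ne_one h
    have h1 : spectralNorm ℚ_[p] F (x.1 * x.1⁻¹) =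
        spectralNorm ℚ_[p] F x.1 * spectralNorm ℚ_[p] F x.1⁻¹ := spectralAlgNorm_mul _ _
    rw [mul_inv_cancel₀ h0, spectralNorm_one, h, one_mul] at h1
    exact IsUnit.of_mul_eq_one ⟨x.1⁻¹, (mem_integers_iff p _).mpr h1.symm.le⟩
      (Subtype.ext (mul_inv_cancel₀ h0))

instance : IsLocalRing (Integers p F) := by
  refine IsLocalRing.of_nonunits_add fun a b ha hb => ?_
  rw [mem_nonunits_iff, isUnit_integers_iff] at ha hb ⊢
  have ha' := lt_of_le_of_ne ((mem_integers_iff p _).mp a.2) ha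
  have hb' := lt_of_le_of_ne ((mem_integers_iff p _).mp b.2) hb
  refine ne_of_lt (lt_of_le_of_lt ?_ (max_lt ha' hb'))
  exact isNonarchimedean_spectralNorm a.1 b.1

theorem not_isUnit_natCast : ¬IsUnit (p : Integers p F) := by
  rw [isUnit_integers_iff]
  have h : ((p : Integers p F) : F) = algebraMap ℚ_[p] F p := by simp
  rw [h, spectralNorm_extends]
  exact Padic.norm_p_lt_one.ne

instance : IsDiscreteValuationRing (Integers p F) := by
  have hf : ¬IsField (Integers p F) := fun h => by
    obtain ⟨b, hb⟩ := h.mul_inv_cancel (natCast_integers_ne_zero p F)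
    exact not_isUnit_natCast p F (IsUnit.of_mul_eq_one b hb)
  exact ((IsDiscreteValuationRing.TFAE (Integers p F) hf).out 0 2).mpr
    (inferInstance : IsDedekindDomain (Integers p F))

end Integers

section Topology

variable (p : ℕ) [Fact p.Prime] (F : Type*) [Field F] [Algebra ℚ_[p] F]

/-- The `p`-adic uniform structure on the ring of integers. -/
noncomputable instance : UniformSpace (Integers p F) :=
  letI : TopologicalSpace (Integers p F) := (Ideal.span {(p : Integers p F)}).adicTopology
  haveI : IsTopologicalRing (Integers p F) :=
    (Ideal.span {(p : Integers p F)}).ringFilterBasis.isTopologicalRing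
  IsTopologicalAddGroup.rightUniformSpace (Integers p F)

theorem isAdic_integers : IsAdic (Ideal.span {(p : Integers p F)}) := rfl

theorem hasBasis_nhds_zero_integers : (𝓝 (0 : Integers p F)).HasBasis (fun _ : ℕ => True)
    fun n => {x | (p : Integers p F) ^ n ∣ x} := by
  convert (Ideal.span {(p : Integers p F)}).hasBasis_nhds_zero_adic using 2 with n
  ext x
  rw [Ideal.span_singleton_pow, SetLike.mem_coe, Ideal.mem_span_singleton]
  rfl

instance : IsTopologicalRing (Integers p F) :=
  (Ideal.span {(p : Integers p F)}).ringFilterBasis.isTopologicalRing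

instance : IsUniformAddGroup (Integers p F) :=
  letI : TopologicalSpace (Integers p F) := (Ideal.span {(p : Integers p F)}).adicTopology
  isUniformAddGroup_of_addCommGroup

instance : IsLinearTopology (Integers p F) (Integers p F) :=
  (Ideal.span {(p : Integers p F)}).isLinearTopology

instance [FiniteDimensional ℚ_[p] F] : T2Space (Integers p F) := by
  rw [← (isAdic_integers p F).isHausdorff_iff]
  refine IsHausdorff.of_isDomain _ ?_
  rw [Ne, Ideal.span_singleton_eq_top]
  exact not_isUnit_natCast p F

/-- The multiples of an integer `b`. -/
noncomputable def smulInteger (b : Integers p F) : ℤ_[p] →+ Integers p F :=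
  (LinearMap.toSpanSingleton (PadicInt.subring p) (Integers p F) b).toAddMonoidHom

theorem continuous_smulInteger (b : Integers p F) : Continuous (smulInteger p F b) := by
  refine continuous_of_continuousAt_zero (smulInteger p F b) ?_
  rw [ContinuousAt, map_zero, (hasBasis_nhds_zero_integers p F).tendsto_right_iff]
  intro n _
  have h : {c : ℤ_[p] | ‖c‖ ≤ (p : ℝ) ^ (-n : ℤ)} ∈ 𝓝 (0 : ℤ_[p]) := by
    have := Metric.closedBall_mem_nhds (0 : ℤ_[p]) (ε := (p : ℝ) ^ (-n : ℤ))
      (zpow_pos (by exact_mod_cast (Fact.out : p.Prime).pos) _)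
    convert this using 1
    ext c
    simp
  filter_upwards [h] with c hc
  rw [PadicInt.norm_le_pow_iff_mem_span_pow, Ideal.mem_span_singleton] at hc
  obtain ⟨d, rfl⟩ := hc
  refine ⟨smulInteger p F b d, ?_⟩
  have h1 : ((p : ℤ_[p]) ^ n * d) = p ^ n • d := by rw [nsmul_eq_mul, Nat.cast_pow]
  rw [h1, map_nsmul, nsmul_eq_mul, Nat.cast_pow]

instance [FiniteDimensional ℚ_[p] F] : CompactSpace (Integers p F) := by
  obtain ⟨n, s, hs⟩ := Module.Finite.exists_fin (R := PadicInt.subring p) (M := Integers p F)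
  have hc : Continuous fun c : Fin n → ℤ_[p] => ∑ i, smulInteger p F (s i) (c i) :=
    continuous_finsetSum _ fun i _ =>
      (continuous_smulInteger p F (s i)).comp (continuous_apply i)
  rw [← isCompact_univ_iff]
  convert isCompact_range hc
  symm
  rw [Set.eq_univ_iff_forall]
  intro x
  have hx : x ∈ Submodule.span (PadicInt.subring p) (Set.range s) := by rw [hs]; trivial
  obtain ⟨c, hc⟩ := (Submodule.mem_span_range_iff_exists_fun _).mp hx
  exact ⟨c, hc⟩

end Topology

section Uniformizer

variable {p : ℕ} [Fact p.Prime] {F : Type*} [Field F] [Algebra ℚ_[p] F]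

theorem isOpen_of_natCast_pow_mem {I : Ideal (Integers p F)} {n : ℕ}
    (h : (p : Integers p F) ^ n ∈ I) : IsOpen (I : Set (Integers p F)) := by
  refine I.toAddSubgroup.isOpen_of_mem_nhds (g := 0) ?_
  refine mem_of_superset ((hasBasis_nhds_zero_integers p F).mem_of_mem (i := n) trivial) ?_
  exact fun x hx => I.mem_of_dvd hx h

theorem isTopologicallyNilpotent_of_natCast_dvd_pow {a : Integers p F} {n : ℕ}
    (h : (p : Integers p F) ∣ a ^ n) : IsTopologicallyNilpotent a := by
  rw [IsTopologicallyNilpotent, (hasBasis_nhds_zero_integers p F).tendsto_right_iff]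
  exact fun k _ => eventually_atTop.mpr ⟨n * k, fun m hm =>
    (pow_dvd_pow_of_dvd h k).trans ((pow_mul a n k).symm ▸ pow_dvd_pow a hm)⟩

variable [FiniteDimensional ℚ_[p] F] {π : Integers p F} (hπ : Irreducible π)

include hπ

theorem dvd_of_not_isUnit {a : Integers p F} (ha : ¬IsUnit a) : π ∣ a := by
  have h := (IsLocalRing.mem_maximalIdeal a).mpr ha
  rwa [hπ.maximalIdeal_eq, Ideal.mem_span_singleton] at h

theorem uniformizer_dvd_natCast : π ∣ (p : Integers p F) :=
  dvd_of_not_isUnit hπ (not_isUnit_natCast p F)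

theorem exists_natCast_dvd_uniformizer_pow : ∃ n, (p : Integers p F) ∣ π ^ n := by
  obtain ⟨n, hn⟩ := IsDiscreteValuationRing.associated_pow_irreducible
    (natCast_integers_ne_zero p F) hπ
  exact ⟨n, hn.dvd⟩

theorem finite_quotient_span_uniformizer : Finite (Integers p F ⧸ Ideal.span {π}) := by
  have h : (p : Integers p F) ^ 1 ∈ Ideal.span {π} := by
    rw [pow_one, Ideal.mem_span_singleton]
    exact uniformizer_dvd_natCast hπ
  exact (Ideal.span {π}).toAddSubgroup.quotient_finite_of_isOpen (isOpen_of_natCast_pow_mem h)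

theorem charP_quotient_span_uniformizer : CharP (Integers p F ⧸ Ideal.span {π}) p := by
  have : Nontrivial (Integers p F ⧸ Ideal.span {π}) :=
    Ideal.Quotient.nontrivial_iff.mpr (Ideal.span_singleton_eq_top.not.mpr hπ.not_isUnit)
  refine (CharP.charP_iff_prime_eq_zero Fact.out).mpr ?_
  rw [← map_natCast (Ideal.Quotient.mk (Ideal.span {π})), Ideal.Quotient.eq_zero_iff_dvd]
  exact uniformizer_dvd_natCast hπ

theorem isLubinTatePair_residueCard : IsLubinTatePair π (residueCard π) := by
  have : (Ideal.span {π}).IsMaximal := hπ.maximalIdeal_eq ▸ inferInstance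
  have := finite_quotient_span_uniformizer hπ
  have hchar := charP_quotient_span_uniformizer hπ
  let := Fintype.ofFinite (Integers p F ⧸ Ideal.span {π})
  let := Ideal.Quotient.field (Ideal.span {π})
  obtain ⟨n, -, hn⟩ := FiniteField.card (Integers p F ⧸ Ideal.span {π}) p
  have hcard : residueCard π = Fintype.card (Integers p F ⧸ Ideal.span {π}) :=
    Nat.card_eq_fintype_card
  refine ⟨mem_nonZeroDivisors_of_ne_zero hπ.ne_zero, ?_,
    ⟨p, n, Fact.out, n.ne_zero, hcard.trans hn, hchar⟩, fun x => hcard ▸ FiniteField.pow_card x⟩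
  rw [IsLocalRing.jacobson_eq_maximalIdeal ⊥ bot_ne_top, hπ.maximalIdeal_eq]
  exact Ideal.mem_span_singleton_self π

end Uniformizer

section Extension

variable {p : ℕ} [Fact p.Prime] {E F : Type*} [Field E] [Field F] [Algebra ℚ_[p] E]
  [Algebra ℚ_[p] F] [Algebra E F] [IsScalarTower ℚ_[p] E F]

theorem coe_integersMap (a : Integers p E) : (integersMap p E F a : F) = algebraMap E F a := rfl

theorem integersMap_injective : Function.Injective (integersMap p E F) := fun _ _ h =>
  Subtype.ext ((algebraMap E F).injective (congrArg Subtype.val h))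

theorem continuous_integersMap : Continuous (integersMap p E F) := by
  refine continuous_of_continuousAt_zero (integersMap p E F) ?_
  rw [ContinuousAt, map_zero, (hasBasis_nhds_zero_integers p F).tendsto_right_iff]
  intro n _
  refine mem_of_superset ((hasBasis_nhds_zero_integers p E).mem_of_mem (i := n) trivial) ?_
  intro x hx
  have h := map_dvd (integersMap p E F) hx
  rwa [map_pow, map_natCast] at h

theorem dvd_of_integersMap_dvd {a b : Integers p E}
    (h : integersMap p E F b ∣ integersMap p E F a) : b ∣ a := by
  obtain ⟨c, hc⟩ := h
  rcases eq_or_ne b 0 with rfl | hb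
  · rw [map_zero, zero_mul] at hc
    rw [integersMap_injective (hc.trans (map_zero (integersMap p E F)).symm)]
  have hb' : (b : E) ≠ 0 := fun h => hb (Subtype.ext h)
  have hquot : algebraMap E F (a / b : E) = c := by
    have h := congrArg Subtype.val hc
    rw [Subalgebra.coe_mul, coe_integersMap, coe_integersMap] at h
    rw [map_div₀, h, mul_div_cancel_left₀]
    exact (_root_.map_ne_zero _).mpr hb'
  have hint : IsIntegral (PadicInt.subring p) (a / b : E) :=
    (isIntegral_algHom_iff ((IsScalarTower.toAlgHom ℚ_[p] E F).restrictScalars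
      (PadicInt.subring p)) (algebraMap E F).injective).mp (hquot.symm ▸ c.2)
  exact ⟨⟨_, hint⟩, Subtype.ext (mul_div_cancel₀ _ hb').symm⟩

end Extension

section Torsion

theorem monic_basicPoly {R : Type*} [CommRing R] {π : R} (hq : 2 ≤ residueCard π) :
    (basicPoly π).Monic := by
  rw [basicPoly, add_comm]
  exact Polynomial.monic_X_pow_add
    ((Polynomial.degree_C_mul_X_le π).trans_lt (by exact_mod_cast hq))

theorem natDegree_basicPoly {R : Type*} [CommRing R] [IsDomain R] {π : R}
    (hq : 2 ≤ residueCard π) : (basicPoly π).natDegree = residueCard π := by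
  have h := (monic_natDegree_trinomial hq π 0).2
  rwa [map_zero, sub_zero, add_comm] at h

theorem separable_trinomial {k : Type*} [Field k] [CharZero k] {a : k} (ha : a ≠ 0) {n : ℕ}
    (hn : 2 ≤ n) : (Polynomial.C a * Polynomial.X + Polynomial.X ^ n).Separable := by
  obtain ⟨m, rfl⟩ := Nat.exists_eq_add_of_le' hn
  have hm : ((m : k) + 1) ≠ 0 := by exact_mod_cast m.succ_ne_zero
  have h1 : (Polynomial.C a⁻¹ * Polynomial.C a : k[X]) = 1 := by
    rw [← Polynomial.C_mul, inv_mul_cancel₀ ha, Polynomial.C_1]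
  have h2 : (Polynomial.C ((m : k) + 1)⁻¹ * ((m : k[X]) + 1) : k[X]) = 1 := by
    have : (Polynomial.C ((m : k) + 1) : k[X]) = (m : k[X]) + 1 := by simp
    rw [← this, ← Polynomial.C_mul, inv_mul_cancel₀ hm, Polynomial.C_1]
  set b : k[X] := Polynomial.C a⁻¹
  set c : k[X] := Polynomial.C ((m : k) + 1)⁻¹
  have hd : Polynomial.derivative (Polynomial.C a * Polynomial.X + Polynomial.X ^ (m + 2) : k[X]) =
      Polynomial.C a + ((m : k[X]) + 2) * Polynomial.X ^ (m + 1) := by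
    simp
    ring
  refine ⟨-(b * b * c * ((m : k[X]) + 2) ^ 2 * Polynomial.X ^ m),
    b + b * b * c * ((m : k[X]) + 2) * Polynomial.X ^ (m + 1), ?_⟩
  rw [hd]
  linear_combination h1 - b * c * (m + 1) * (m + 2) * Polynomial.X ^ (m + 1) * h1 -
    b * (m + 2) * Polynomial.X ^ (m + 1) * h2

variable {p : ℕ} [Fact p.Prime] {K : Type*} [Field K] [Algebra ℚ_[p] K] {π : Integers p K}

instance [FiniteDimensional ℚ_[p] K] : FiniteDimensional ℚ_[p] (TorsionField p π) :=
  Module.Finite.trans K (TorsionField p π)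

theorem mem_torsionPoints (hq : 2 ≤ residueCard π) {z : TorsionIntegers p π} :
    z ∈ torsionPoints p π ↔ inclK p π π * z + z ^ residueCard π = 0 := by
  classical
  rw [torsionPoints, Multiset.mem_toFinset,
    Polynomial.mem_roots ((monic_basicPoly hq).map _).ne_zero]
  simp [basicPoly]

theorem mem_rootSet_basicPoly (hq : 2 ≤ residueCard π) {z : TorsionField p π} :
    z ∈ ((basicPoly π).map (algebraMap (Integers p K) K)).rootSet (TorsionField p π) ↔
      algebraMap K (TorsionField p π) π * z + z ^ residueCard π = 0 := by
  rw [Polynomial.mem_rootSet_of_ne ((monic_basicPoly hq).map _).ne_zero]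
  simp [basicPoly]

theorem isIntegral_of_mem_rootSet_basicPoly (hq : 2 ≤ residueCard π) {z : TorsionField p π}
    (hz : algebraMap K (TorsionField p π) π * z + z ^ residueCard π = 0) :
    IsIntegral (PadicInt.subring p) z := by
  rcases eq_or_ne z 0 with rfl | hz0
  · exact isIntegral_zero
  have h : z ^ (residueCard π - 1) = -(inclK p π π : TorsionField p π) := by
    refine mul_left_cancel₀ hz0 ?_
    rw [mul_pow_sub_one (by omega)]
    have : (inclK p π π : TorsionField p π) = algebraMap K _ (π : K) := rfl
    rw [this]
    linear_combination hz
  exact IsIntegral.of_pow (n := residueCard π - 1) (by omega) (h ▸ (inclK p π π).2.neg)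

theorem map_subtype_torsionPoints (hq : 2 ≤ residueCard π) :
    ((torsionPoints p π).map (Function.Embedding.subtype _) : Set (TorsionField p π)) =
      ((basicPoly π).map (algebraMap (Integers p K) K)).rootSet (TorsionField p π) := by
  ext z
  rw [mem_rootSet_basicPoly hq, Finset.mem_coe, Finset.mem_map]
  constructor
  · rintro ⟨a, ha, rfl⟩
    exact congrArg Subtype.val ((mem_torsionPoints hq).mp ha)
  · exact fun hz => ⟨⟨z, isIntegral_of_mem_rootSet_basicPoly hq hz⟩,
      (mem_torsionPoints hq).mpr (Subtype.ext hz), rfl⟩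

theorem card_torsionPoints (hπ : π ≠ 0) (hq : 2 ≤ residueCard π) :
    (torsionPoints p π).card = residueCard π := by
  have : CharZero K := charZero_of_injective_algebraMap (algebraMap ℚ_[p] K).injective
  have hsep : ((basicPoly π).map (algebraMap (Integers p K) K)).Separable := by
    have h := separable_trinomial (a := (π : K)) (fun h => hπ (Subtype.ext h)) hq
    simpa [basicPoly] using h
  have hcard := Polynomial.card_rootSet_eq_natDegree hsep
    (Polynomial.SplittingField.splits ((basicPoly π).map (algebraMap (Integers p K) K)))
  rw [(monic_basicPoly hq).natDegree_map, natDegree_basicPoly hq, ← Nat.card_eq_fintype_card,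
    Nat.card_coe_set_eq, ← map_subtype_torsionPoints hq, Set.ncard_coe_finset,
    Finset.card_map] at hcard
  exact hcard

end Torsion

section BaseChange

variable {R S : Type*} [CommRing R] [CommRing S] (f : R →+* S) {F : FormalGroup R}

theorem natCast_le_order_map {σ : Type*} {n : ℕ} {φ : MvPowerSeries σ R}
    (h : (n : ℕ∞) ≤ φ.order) : (n : ℕ∞) ≤ (MvPowerSeries.map f φ).order := by
  rw [natCast_le_order_iff] at h ⊢
  intro d hd
  rw [MvPowerSeries.coeff_map, h d hd, map_zero]

theorem natCast_le_order_map_sub {n : ℕ}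
    (h : (n : ℕ∞) ≤ (F.toPowerSeries - (MvPowerSeries.X 0 + MvPowerSeries.X 1)).order) :
    (n : ℕ∞) ≤ ((F.map f).toPowerSeries - (MvPowerSeries.X 0 + MvPowerSeries.X 1)).order := by
  have h' := natCast_le_order_map f h
  rwa [map_sub, map_add, MvPowerSeries.map_X, MvPowerSeries.map_X] at h'

theorem map_subst_pair {τ : Type*} {a b : MvPowerSeries τ R}
    (ha : MvPowerSeries.constantCoeff a = 0) (hb : MvPowerSeries.constantCoeff b = 0)
    (φ : MvPowerSeries (Fin 2) R) : MvPowerSeries.map f (MvPowerSeries.subst ![a, b] φ) =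
      MvPowerSeries.subst ![MvPowerSeries.map f a, MvPowerSeries.map f b]
        (MvPowerSeries.map f φ) := by
  rw [MvPowerSeries.map_subst
    (MvPowerSeries.hasSubst_of_constantCoeff_zero (constantCoeff_vec_two ha hb)),
    vec_two_apply (MvPowerSeries.map f)]

instance isComm_map [F.IsComm] : (F.map f).IsComm where
  comm := by
    have h := congrArg (MvPowerSeries.map f) (FormalGroup.IsComm.comm (F := F))
    rwa [map_subst_pair f (MvPowerSeries.constantCoeff_X _) (MvPowerSeries.constantCoeff_X _),
      MvPowerSeries.map_X, MvPowerSeries.map_X] at h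

instance hasInverse_map [hF : HasInverse F] : HasInverse (F.map f) where
  exists_inverse := by
    obtain ⟨ι, h0, hι⟩ := hF.exists_inverse
    refine ⟨MvPowerSeries.map f ι, by rw [MvPowerSeries.constantCoeff_map, h0, map_zero], ?_⟩
    have h := congrArg (MvPowerSeries.map f) hι
    rwa [PowerSeries.X, map_subst_pair f (MvPowerSeries.constantCoeff_X ()) h0,
      MvPowerSeries.map_X, map_zero] at h

theorem IsFormalEndomorphism.map {φ : R⟦X⟧} (hφ : IsFormalEndomorphism F φ) :
    IsFormalEndomorphism (F.map f) (PowerSeries.map f φ) where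
  constantCoeff_eq_zero :=
    (MvPowerSeries.constantCoeff_map f φ).trans (by rw [hφ.constantCoeff_eq_zero, map_zero])
  subst_eq := by
    have hX (i : Fin 2) := MvPowerSeries.constantCoeff_X (R := R) i
    have h := congrArg (MvPowerSeries.map f) hφ.subst_eq
    rw [PowerSeries.subst, MvPowerSeries.map_subst
      (MvPowerSeries.hasSubst_of_constantCoeff_zero fun _ => F.zero_constantCoeff),
      MvPowerSeries.map_subst (MvPowerSeries.hasSubst_of_constantCoeff_zero fun i =>
        PowerSeries.constantCoeff_subst_eq_zero (hX i) _ hφ.constantCoeff_eq_zero)] at h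
    refine h.trans (congrArg (fun g => MvPowerSeries.subst g _) ?_)
    ext i : 1
    rw [PowerSeries.subst, MvPowerSeries.map_subst
      (MvPowerSeries.hasSubst_of_constantCoeff_zero fun _ => hX i), MvPowerSeries.map_X]
    rfl

variable {π : R}

theorem hasInverse_lubinTateLaw (hπ : IsLubinTatePair π (residueCard π)) :
    HasInverse (lubinTateLaw (basicSeries π)) where
  exists_inverse :=
    ⟨_, (isLubinTateSeries_lubinTateEndo hπ (-1)).1, subst_X_lubinTateEndo_neg_one hπ⟩

theorem isFormalEndomorphism_lubinTateEndo (hπ : IsLubinTatePair π (residueCard π)) (a : R) :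
    IsFormalEndomorphism (lubinTateLaw (basicSeries π)) (lubinTateEndo (basicSeries π) a) :=
  ⟨(isLubinTateSeries_lubinTateEndo hπ a).1, subst_lubinTateLaw_lubinTateEndo hπ a⟩

theorem lubinTateEndo_mul_self_eq (hπ : IsLubinTatePair π (residueCard π)) (a : R) :
    lubinTateEndo (basicSeries π) (a * π) =
      PowerSeries.C π * lubinTateEndo (basicSeries π) a +
        lubinTateEndo (basicSeries π) a ^ residueCard π := by
  rw [lubinTateEndo_mul_self hπ, ← (isLubinTateEndo_lubinTateEndo hπ a).2.2, subst_basicSeries]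
  · rfl
  · exact PowerSeries.HasSubst.of_constantCoeff_zero (isLubinTateSeries_lubinTateEndo hπ a).1

end BaseChange

section CompSeries

variable {p : ℕ} {R A : Type*} [CommRing R] [UniformSpace R] [IsUniformAddGroup R]
  [IsTopologicalRing R] [CommRing A] [UniformSpace A] [IsUniformAddGroup A] [IsTopologicalRing A]
  [IsLinearTopology A A] [T2Space A] [CompleteSpace A] [Algebra R A] [ContinuousSMul R A]

theorem compSeries_map_algebraMap (hA : IsAdic (Ideal.span {(p : A)})) {σ : Type*} [Finite σ]
    (h : MvPowerSeries σ R) (g : σ → topologicalNilradical A⟦X⟧) :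
    compSeries p (MvPowerSeries.map (algebraMap R A) h) (fun i => (g i : A⟦X⟧)) = evalAt g h := by
  refine PowerSeries.ext fun n => ?_
  have hsum := (hasSum_evalAt g h).map (MvPowerSeries.coeff (R := A) (.single () n))
    (MvPowerSeries.WithPiTopology.continuous_coeff A _)
  rw [compSeries, PowerSeries.coeff_mk, ← show _ = _ from hA]
  refine Eq.trans (tsum_congr fun d => ?_) hsum.tsum_eq
  rw [MvPowerSeries.coeff_map, Function.comp_apply, ← Algebra.smul_def]
  rfl

theorem comp₁_map_algebraMap (hA : IsAdic (Ideal.span {(p : A)})) (h : R⟦X⟧)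
    (g : topologicalNilradical A⟦X⟧) :
    comp₁ p (h.map (algebraMap R A)) g = evalAt (fun _ : Unit => g) h :=
  compSeries_map_algebraMap hA h fun _ => g

variable [IsLinearTopology R R] {F G : FormalGroup R} {ι : Type*}

theorem fglAdd_map_algebraMap (hA : IsAdic (Ideal.span {(p : A)}))
    (g₁ g₂ : topologicalNilradical A⟦X⟧) : fglAdd p (G.map (algebraMap R A)) g₁ g₂ =
      evalNil ![g₁, g₂] G.toPowerSeries G.zero_constantCoeff := by
  rw [fglAdd, ← vec_two_apply Subtype.val]
  exact compSeries_map_algebraMap hA G.toPowerSeries ![g₁, g₂]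

theorem foldr_fglAdd_eq_val_sum (hA : IsAdic (Ideal.span {(p : A)})) {g : ι → A⟦X⟧}
    {a : ι → Points G A⟦X⟧} {l : List ι} (h : ∀ z ∈ l, g z = (a z).val) :
    l.foldr (fun z acc => fglAdd p (G.map (algebraMap R A)) (g z) acc) 0 =
      (l.map a).sum.val := by
  induction l with
  | nil => rfl
  | cons z l ih =>
    rw [List.foldr_cons, ih fun w hw => h w (List.mem_cons_of_mem _ hw), h z List.mem_cons_self,
      List.map_cons, List.sum_cons, fglAdd_map_algebraMap hA, Points.val_add]

variable [T2Space R] [CompleteSpace R] [G.IsComm] [HasInverse G]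

theorem fglSum_eq_val_sum (hA : IsAdic (Ideal.span {(p : A)})) {T : Finset ι} {g : ι → A⟦X⟧}
    {a : T → Points G A⟦X⟧} (h : ∀ z : T, g z = (a z).val) :
    fglSum p (G.map (algebraMap R A)) T g = (∑ z, a z).val := by
  have hext (z : T) : Function.extend Subtype.val a 0 z = a z :=
    Subtype.val_injective.extend_apply a 0 z
  rw [fglSum, foldr_fglAdd_eq_val_sum hA (a := Function.extend Subtype.val a 0),
    Finset.sum_map_toList, ← Finset.sum_coe_sort T, Finset.sum_congr rfl fun z _ => hext z]
  intro z hz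
  rw [hext ⟨z, Finset.mem_toList.mp hz⟩, h ⟨z, Finset.mem_toList.mp hz⟩]

theorem fglSum_comp₁_eq_trace (hA : IsAdic (Ideal.span {(p : A)})) {T : Finset A}
    {z : T → topologicalNilradical A} (hz : ∀ t, (z t : A) = t) (s : Points G R⟦X⟧) :
    fglSum p (G.map (algebraMap R A)) T
      (fun t => comp₁ p (PowerSeries.map (algebraMap R A) s.val)
        (fglAdd p (F.map (algebraMap R A)) PowerSeries.X (PowerSeries.C t))) =
      (trace F G z s).val := by
  rw [trace_apply]
  refine fglSum_eq_val_sum hA fun t => ?_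
  rw [Points.coe_val_map, ← comp₁_map_algebraMap hA, shift, ← fglAdd_map_algebraMap hA, ← hz t]
  rfl

theorem comp₁_comp₁_eq_endo (hA : IsAdic (Ideal.span {(p : A)})) {π : R} {q : ℕ} (hq : q ≠ 0)
    {φ : R⟦X⟧} (hφ : IsFormalEndomorphism G φ) (s : Points G R⟦X⟧) :
    comp₁ p (PowerSeries.map (algebraMap R A) φ) (comp₁ p (PowerSeries.map (algebraMap R A) s.val)
      (PowerSeries.map (algebraMap R A) (lubinTateVar π q ()))) =
      (Points.map (pullback A π hq) (Points.endo hφ s)).val := by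
  have hy : PowerSeries.map (algebraMap R A) (lubinTateVar π q ()) =
      (lubinTatePoint (B := A⟦X⟧) π hq (nilX ()) : A⟦X⟧) := by
    rw [coe_lubinTatePoint, lubinTateVar, map_add, map_mul, map_pow, MvPowerSeries.algebraMap_apply]
    exact congrArg₂ (· + ·) (congrArg₂ (· * ·) (MvPowerSeries.map_C ..) (MvPowerSeries.map_X ..))
      (congrArg (· ^ q) (MvPowerSeries.map_X ..))
  rw [hy, comp₁_map_algebraMap hA]
  have hmap := comp₁_map_algebraMap (p := p) hA φ (nilMap (pullback A π hq) s.val)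
  exact hmap.trans (apply_evalAt (pullback A π hq) (fun _ => s.val) φ).symm

end CompSeries

section Criterion

theorem mem_topologicalNilradical_of_dvd_constantCoeff {R : Type*} [CommRing R]
    [TopologicalSpace R] [IsLinearTopology R R] {π : R} (hπ : IsTopologicallyNilpotent π)
    {s : R⟦X⟧} (hs : π ∣ PowerSeries.constantCoeff s) : s ∈ topologicalNilradical R⟦X⟧ :=
  MvPowerSeries.LinearTopology.isTopologicallyNilpotent_of_constantCoeff
    (Ideal.mem_of_dvd (topologicalNilradical R) hs hπ)

variable {p : ℕ} {R A ι : Type*} [CommRing R] [UniformSpace R] [IsUniformAddGroup R]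
  [IsTopologicalRing R] [IsLinearTopology R R] [T2Space R] [CompactSpace R]
  [CommRing A] [IsDomain A] [UniformSpace A] [IsUniformAddGroup A] [IsTopologicalRing A]
  [IsLinearTopology A A] [T2Space A] [CompactSpace A] [Algebra R A] [ContinuousSMul R A]
  {π ϖ : R} {q k : ℕ} {F G : FormalGroup R} [G.IsComm] [HasInverse G]
  (h : IsLubinTatePair π q) (hF : IsLubinTateSeries π q F.toPowerSeries)
  (hG : ((3 : ℕ) : ℕ∞) ≤ (G.toPowerSeries - (MvPowerSeries.X 0 + MvPowerSeries.X 1)).order)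
  (hrefl : ∀ a, algebraMap R A π ∣ algebraMap R A a → π ∣ a)
  (hnil : IsTopologicallyNilpotent π) {s : R⟦X⟧} (hs : π ∣ PowerSeries.constantCoeff s)
include h hF hG hrefl hnil hs

theorem exists_eq_iff_of_val_eq_trace [Fintype ι] {z : ι → topologicalNilradical A}
    (hz : IsTorsionFamily π q z) {Φ : Points G R⟦X⟧ →+ Points G R⟦X⟧}
    (hΦ : ∀ m, 1 ≤ m → ∀ a ∈ Points.level G R⟦X⟧ π m, Φ a ∈ Points.level G R⟦X⟧ π (m + 2))
    {f g : R⟦X⟧ → A⟦X⟧} (hf : ∀ a : Points G R⟦X⟧, f a.val = (trace F G z a).val)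
    (hg : ∀ a : Points G R⟦X⟧, g a.val = (Points.map (pullback A π h.ne_zero) (Φ a)).val) :
    (∃ r, (π ∣ PowerSeries.constantCoeff r ∧ f r = g r) ∧ PowerSeries.C π ∣ r - s) ↔
      PowerSeries.C (algebraMap R A π ^ 2) ∣ f s - g s := by
  let point {r : R⟦X⟧} (hr : π ∣ PowerSeries.constantCoeff r) : Points G R⟦X⟧ :=
    ⟨⟨r, mem_topologicalNilradical_of_dvd_constantCoeff hnil hr⟩⟩
  have hlevel (a b : Points G R⟦X⟧) :
      a - b ∈ Points.level G R⟦X⟧ π 1 ↔ PowerSeries.C π ∣ a.val.val - b.val.val := by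
    rw [Points.sub_mem_level, pow_one]
    rfl
  have hmain := exists_trace_eq_iff h hF hz hG hrefl hnil hΦ (point hs)
  rw [Points.sub_mem_level, ← hf, ← hg, MvPowerSeries.algebraMap_apply, ← map_pow] at hmain
  refine Iff.trans ⟨?_, ?_⟩ hmain
  · rintro ⟨r, ⟨hr, hfg⟩, hrs⟩
    refine ⟨point hr, Points.ext <| Subtype.ext ?_, (hlevel _ _).mpr hrs⟩
    rwa [← hf, ← hg]
  · rintro ⟨r, hr, hrs⟩
    have hdvd : PowerSeries.C π ∣ r.val.val - s := (hlevel r (point hs)).mp hrs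
    have h0 := map_dvd PowerSeries.constantCoeff hdvd
    rw [PowerSeries.constantCoeff_C, map_sub] at h0
    exact ⟨r.val, ⟨(dvd_sub_left hs).mp h0, by rw [hf, hg, hr]⟩, hdvd⟩

theorem exists_fglSum_eq_comp₁_iff (hA : IsAdic (Ideal.span {(p : A)})) {T : Finset A}
    {z : T → topologicalNilradical A} (hzT : ∀ t, (z t : A) = t) (hz : IsTorsionFamily π q z)
    {φ ψ : R⟦X⟧} (hφ : IsFormalEndomorphism G φ) (hψ : MvPowerSeries.constantCoeff ψ = 0)
    (hφψ : φ = PowerSeries.C ϖ * ψ + ψ ^ k) (hϖ : π ^ 2 ∣ ϖ) (hk : 3 ≤ k) :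
    let f (r : R⟦X⟧) := fglSum p (G.map (algebraMap R A)) T
      (fun t => comp₁ p (PowerSeries.map (algebraMap R A) r)
        (fglAdd p (F.map (algebraMap R A)) PowerSeries.X (PowerSeries.C t)))
    let g (r : R⟦X⟧) := comp₁ p (PowerSeries.map (algebraMap R A) φ)
      (comp₁ p (PowerSeries.map (algebraMap R A) r)
        (PowerSeries.map (algebraMap R A) (lubinTateVar π q ())))
    (∃ r, (π ∣ PowerSeries.constantCoeff r ∧ f r = g r) ∧ PowerSeries.C π ∣ r - s) ↔
      PowerSeries.C (algebraMap R A π ^ 2) ∣ f s - g s :=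
  exists_eq_iff_of_val_eq_trace h hF hG hrefl hnil hs hz
    (fun _ hm _ ha => Points.endo_mem_level_add_two hφ hψ hφψ hϖ hk hm ha)
    (fglSum_comp₁_eq_trace hA hzT) (comp₁_comp₁_eq_endo hA h.ne_zero hφ)

end Criterion

section Setting

variable {p : ℕ} [Fact p.Prime] {K : Type*} [Field K] [Algebra ℚ_[p] K]

noncomputable instance (πK : Integers p K) : Algebra (Integers p K) (TorsionIntegers p πK) :=
  (inclK p πK).toAlgebra

instance (πK : Integers p K) : ContinuousSMul (Integers p K) (TorsionIntegers p πK) :=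
  continuousSMul_of_algebraMap _ _ continuous_integersMap

theorem dvd_of_algebraMap_dvd {πK a b : Integers p K}
    (h : algebraMap (Integers p K) (TorsionIntegers p πK) b ∣ algebraMap _ _ a) : b ∣ a :=
  dvd_of_integersMap_dvd (E := K) (F := TorsionField p πK) h

theorem isTopologicallyNilpotent_uniformizer [FiniteDimensional ℚ_[p] K] {π : Integers p K}
    (hπ : Irreducible π) : IsTopologicallyNilpotent π :=
  (exists_natCast_dvd_uniformizer_pow hπ).elim fun _ =>
    isTopologicallyNilpotent_of_natCast_dvd_pow

variable [FiniteDimensional ℚ_[p] K] {πK : Integers p K} (hπK : Irreducible πK)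
include hπK

theorem isTopologicallyNilpotent_torsionPoints {z : TorsionIntegers p πK}
    (hz : z ∈ torsionPoints p πK) : IsTopologicallyNilpotent z := by
  obtain ⟨n, hn⟩ := exists_natCast_dvd_uniformizer_pow hπK
  rw [mem_torsionPoints (isLubinTatePair_residueCard hπK).two_le] at hz
  have hdvd : inclK p πK πK ∣ z ^ residueCard πK :=
    (dvd_add_right (dvd_mul_right _ z)).mp (hz ▸ dvd_zero _)
  have hp := map_dvd (inclK p πK) hn
  rw [map_natCast, map_pow] at hp
  replace hp := hp.trans (pow_dvd_pow_of_dvd hdvd n)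
  rw [← pow_mul] at hp
  exact isTopologicallyNilpotent_of_natCast_dvd_pow hp

/-- The roots of `f_K` as topologically nilpotent elements. -/
noncomputable def torsionPoint (z : torsionPoints p πK) :
    topologicalNilradical (TorsionIntegers p πK) :=
  ⟨z, isTopologicallyNilpotent_torsionPoints hπK z.2⟩

theorem isTorsionFamily_torsionPoint :
    IsTorsionFamily πK (residueCard πK) (torsionPoint hπK) where
  card_eq := (Fintype.card_coe _).trans
    (card_torsionPoints hπK.ne_zero (isLubinTatePair_residueCard hπK).two_le)
  injective _ _ h := Subtype.ext (Subtype.mk.inj h)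
  root z := (mem_torsionPoints (isLubinTatePair_residueCard hπK).two_le).mp z.2

end Setting

end ColemanTrace

open ColemanTrace in
theorem theorem2p1p1_general (p : ℕ) [Fact p.Prime] (L K : Type*) [Field L] [Field K]
    [Algebra ℚ_[p] L] [Algebra ℚ_[p] K] [Algebra L K] [IsScalarTower ℚ_[p] L K]
    [FiniteDimensional ℚ_[p] L] [FiniteDimensional L K]
    (πL : ColemanTrace.Integers p L) (hπL : Irreducible πL)
    (πK : ColemanTrace.Integers p K) (hπK : Irreducible πK)
    (hqL : 3 ≤ ColemanTrace.residueCard πL)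
    (hram : πK ^ 2 ∣ ColemanTrace.integersMap p L K πL)
    (α : ColemanTrace.Integers p L) (hdvd : πL ∣ α)
    (s : PowerSeries (ColemanTrace.Integers p K))
    (hs : πK ∣ PowerSeries.constantCoeff s) :
    (∃ r ∈ ColemanTrace.interpolating p πL πK α, PowerSeries.C πK ∣ r - s) ↔
      PowerSeries.C (ColemanTrace.inclK p πK πK ^ 2) ∣
        ColemanTrace.traceSum p πL πK s - ColemanTrace.endoSide p πL πK α s := by
  have : FiniteDimensional ℚ_[p] K := Module.Finite.trans L K
  have hpairL := isLubinTatePair_residueCard hπL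
  have hpairK := isLubinTatePair_residueCard hπK
  have := isComm_lubinTateLaw hpairL
  have := hasInverse_lubinTateLaw hpairL
  obtain ⟨β, rfl⟩ := hdvd
  have hαβ := congrArg (PowerSeries.map (integersMap p L K)) (lubinTateEndo_mul_self_eq hpairL β)
  rw [map_add, map_mul, map_pow, PowerSeries.map_C] at hαβ
  have hmain := exists_fglSum_eq_comp₁_iff (A := TorsionIntegers p πK)
    (F := lubinTateLaw (basicSeries πK))
    (G := (lubinTateLaw (basicSeries πL)).map (integersMap p L K))
    hpairK (isLubinTateSeries_lubinTateLaw hpairK)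
    (natCast_le_order_map_sub _
      ((Nat.cast_le.mpr hqL).trans (residueCard_le_order_lubinTateLaw_sub hpairL)))
    (fun _ => dvd_of_algebraMap_dvd) (isTopologicallyNilpotent_uniformizer hπK) hs
    (isAdic_integers p _) (fun _ => rfl) (isTorsionFamily_torsionPoint hπK)
    ((isFormalEndomorphism_lubinTateEndo hpairL (β * πL)).map (integersMap p L K))
    ((isFormalEndomorphism_lubinTateEndo hpairL β).map (integersMap p L K)).1 hαβ hram hqL
  have hend : lubinTateVar πK (residueCard πK) () = lubinTateEndo (basicSeries πK) πK := by
    rw [lubinTateEndo_self hpairK, basicSeries_eq_lubinTateVar πK]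
  rw [hend] at hmain
  rw [mul_comm πL β]
  exact hmain

theorem theorem2p1p1 (p : ℕ) [Fact p.Prime] (L K : Type*) [Field L] [Field K]
    [Algebra ℚ_[p] L] [Algebra ℚ_[p] K] [Algebra L K] [IsScalarTower ℚ_[p] L K]
    [FiniteDimensional ℚ_[p] L] [FiniteDimensional L K]
    (πL : ColemanTrace.Integers p L) (hπL : Irreducible πL)
    (πK : ColemanTrace.Integers p K) (hπK : Irreducible πK)
    (hqL : 3 ≤ ColemanTrace.residueCard πL)
    (hram : πK ^ 2 ∣ ColemanTrace.integersMap p L K πL)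
    (f : ℕ) (hf : ColemanTrace.residueCard πK = ColemanTrace.residueCard πL ^ f)
    (α : ColemanTrace.Integers p L)
    (hα : α * πL ^ f = (ColemanTrace.residueCard πK : ColemanTrace.Integers p L))
    (hdvd : πL ∣ α)
    (s : PowerSeries (ColemanTrace.Integers p K))
    (hs : πK ∣ PowerSeries.constantCoeff s) :
    (∃ r ∈ ColemanTrace.interpolating p πL πK α, PowerSeries.C πK ∣ r - s) ↔
      PowerSeries.C (ColemanTrace.inclK p πK πK ^ 2) ∣
        ColemanTrace.traceSum p πL πK s - ColemanTrace.endoSide p πL πK α s :=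
  theorem2p1p1_general p L K πL hπL πK hπK hqL hram α hdvd s hs
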